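/- Let $H$ be a separable complex Hilbert space, $\mathcal B(H)$ the algebra of bounded operators on $H$, and $\mathcal D\subseteq\mathcal B(H)$ a maximal abelian selfadjoint algebra (masa). For a linear subspace $\mathcal X\subseteq\mathcal B(H)$ and $T\in\mathcal B(H)$ put $$d(T,\mathcal X)=\inf_{X\in\mathcal X}\|T-X\|,\qquad \alpha(T,\mathcal X)=\sup_{\|\xi\|=1}\ \inf_{X\in\mathcal X}\|T\xi-X\xi\|$$ (the supremum being $0$ if $H=\{0\}$), and call $\mathcal X$ hyperreflexive if there is $k>0$ such that $d(T,\mathcal X)\le k\,\alpha(T,\mathcal X)$ for all $T\in\mathcal B(H)$. A Schur idempotent is a linear, weak* continuous map $\Phi:\mathcal B(H)\to\mathcal B(H)$ with $\Phi\circ\Phi=\Phi$ and $\Phi(ATB)=A\Phi(T)B$ for all $A,B\in\mathcal D$, $T\in\mathcal B(H)$. Let $\mathfrak h$ be the set of Schur idempotents $\Phi$ for which there is $\lambda>0$ with $$\|T-\Phi(T)\|\le\lambda\,\alpha(T,\operatorname{ran}\Phi)\qquad\text{for all }T\in\mathcal B(H),$$ and let $\lambda(\Phi)$ be the infimum of all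 such $\lambda>0$. If $\Phi$ is a contractive Schur idempotent, i.e. $\|\Phi(T)\|\le\|T\|$ for all $T\in\mathcal B(H)$, then $\Phi\in\mathfrak h$ and $\lambda(\Phi)\le 2$. Moreover, $\operatorname{ran}\Phi$ is a ternary masa-bimodule, that is, it is weak* closed, $\mathcal D(\operatorname{ran}\Phi)\mathcal D\subseteq\operatorname{ran}\Phi$, and $ST^*R\in\operatorname{ran}\Phi$ whenever $S,T,R\in\operatorname{ran}\Phi$; and $\operatorname{ran}\Phi$ is hyperreflexive. -/

import Mathlib

open scoped Topology

namespace SchurIdem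

variable {H : Type*} [NormedAddCommGroup H] [InnerProductSpace ℂ H]

/-- The distance `d(T, 𝒳) = inf {‖T - X‖ : X ∈ 𝒳}`. -/
noncomputable def normDist (T : H →L[ℂ] H) (𝒳 : Submodule ℂ (H →L[ℂ] H)) : ℝ :=
  ⨅ X : 𝒳, ‖T - (X : H →L[ℂ] H)‖

/-- The Arveson distance
`α(T, 𝒳) = sup {inf {‖T ξ - X ξ‖ : X ∈ 𝒳} : ‖ξ‖ = 1}`.
The supremum is over a set bounded by `‖T‖`; it is `0` when `H` has no unit vector. -/
noncomputable def arvesonDist (T : H →L[ℂ] H) (𝒳 : Submodule ℂ (H →L[ℂ] H)) : ℝ :=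
  ⨆ ξ : {ξ : H // ‖ξ‖ = 1}, ⨅ X : 𝒳, ‖T ξ - (X : H →L[ℂ] H) ξ‖

/-- `𝒳` is hyperreflexive: `d(T, 𝒳) ≤ k α(T, 𝒳)` for all `T`, for some constant `k > 0`. -/
def IsHyperreflexive (𝒳 : Submodule ℂ (H →L[ℂ] H)) : Prop :=
  ∃ k : ℝ, 0 < k ∧ ∀ T : H →L[ℂ] H, normDist T 𝒳 ≤ k * arvesonDist T 𝒳

/-- The weak* (ultraweak) topology of `B(H)`, as the dual of the trace class: the coarsest topology
making `T ↦ ∑ₙ ⟪yₙ, T xₙ⟫` continuous for all sequences of vectors with `∑ ‖xₙ‖² < ∞` and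
`∑ ‖yₙ‖² < ∞`. -/
@[reducible] noncomputable def weakStar (H : Type*) [NormedAddCommGroup H] [InnerProductSpace ℂ H] :
    TopologicalSpace (H →L[ℂ] H) :=
  ⨅ (x : ℕ → H) (y : ℕ → H) (_ : Summable fun n => ‖x n‖ ^ 2) (_ : Summable fun n => ‖y n‖ ^ 2),
    TopologicalSpace.induced (fun T : H →L[ℂ] H => ∑' n, inner ℂ (y n) (T (x n))) inferInstance

/-- `Φ` is contractive, i.e. `‖Φ‖ ≤ 1` for the operator norm on `B(H)`. -/
def IsContractive (Φ : (H →L[ℂ] H) →ₗ[ℂ] (H →L[ℂ] H)) : Prop :=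
  ∀ T : H →L[ℂ] H, ‖Φ T‖ ≤ ‖T‖

/-- The complement `Φ^⊥ = id - Φ`. -/
def perp (Φ : (H →L[ℂ] H) →ₗ[ℂ] (H →L[ℂ] H)) : (H →L[ℂ] H) →ₗ[ℂ] (H →L[ℂ] H) :=
  LinearMap.id - Φ

/-- The property `‖Φ^⊥(T)‖ ≤ l α(T, ran Φ)` for all `T`. -/
def ArvesonBound (Φ : (H →L[ℂ] H) →ₗ[ℂ] (H →L[ℂ] H)) (l : ℝ) : Prop :=
  ∀ T : H →L[ℂ] H, ‖perp Φ T‖ ≤ l * arvesonDist T (LinearMap.range Φ)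

/-- `λ(Φ)`: the infimum of the positive constants `l` such that
`‖Φ^⊥(T)‖ ≤ l α(T, ran Φ)` for all `T`. It is meant for maps for which such constants exist. -/
noncomputable def lam (Φ : (H →L[ℂ] H) →ₗ[ℂ] (H →L[ℂ] H)) : ℝ :=
  sInf {l : ℝ | 0 < l ∧ ArvesonBound Φ l}

variable [CompleteSpace H]

/-- `D` is a masa: maximal among the abelian selfadjoint algebras of operators on `H`. -/
def IsMasa (D : StarSubalgebra ℂ (H →L[ℂ] H)) : Prop :=
  Maximal (fun E : StarSubalgebra ℂ (H →L[ℂ] H) => ∀ A ∈ E, ∀ B ∈ E, A * B = B * A) D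

/-- A Schur multiplier: a weak* continuous (linear) `D`-bimodule map on `B(H)`. -/
structure IsSchurMultiplier (D : StarSubalgebra ℂ (H →L[ℂ] H))
    (Φ : (H →L[ℂ] H) →ₗ[ℂ] (H →L[ℂ] H)) : Prop where
  weakStar_continuous : Continuous[weakStar H, weakStar H] Φ
  bimodule_map : ∀ A ∈ D, ∀ B ∈ D, ∀ T : H →L[ℂ] H, Φ (A * T * B) = A * Φ T * B

/-- A Schur idempotent: a Schur multiplier `Φ` with `Φ ∘ Φ = Φ`. -/
structure IsSchurIdempotent (D : StarSubalgebra ℂ (H →L[ℂ] H))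
    (Φ : (H →L[ℂ] H) →ₗ[ℂ] (H →L[ℂ] H)) : Prop extends IsSchurMultiplier D Φ where
  idempotent : Φ ∘ₗ Φ = Φ

/-- The class `𝔥` of Schur idempotents `Φ` for which there is `l > 0` with
`‖Φ^⊥(T)‖ ≤ l α(T, ran Φ)` for all `T`. -/
def classH (D : StarSubalgebra ℂ (H →L[ℂ] H)) : Set ((H →L[ℂ] H) →ₗ[ℂ] (H →L[ℂ] H)) :=
  {Φ | IsSchurIdempotent D Φ ∧ ∃ l : ℝ, 0 < l ∧ ArvesonBound Φ l}

/-- A (weak* closed) masa-bimodule: a weak* closed subspace `𝒳` with `D 𝒳 D ⊆ 𝒳`. -/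
structure IsMasaBimodule (D : StarSubalgebra ℂ (H →L[ℂ] H))
    (𝒳 : Submodule ℂ (H →L[ℂ] H)) : Prop where
  weakStar_closed : IsClosed[weakStar H] (𝒳 : Set (H →L[ℂ] H))
  mul_mem : ∀ A ∈ D, ∀ B ∈ D, ∀ X ∈ 𝒳, A * X * B ∈ 𝒳

/-- A ternary masa-bimodule: a masa-bimodule `𝒳` with `S T* R ∈ 𝒳` whenever `S, T, R ∈ 𝒳`. -/
structure IsTernaryMasaBimodule (D : StarSubalgebra ℂ (H →L[ℂ] H))
    (𝒳 : Submodule ℂ (H →L[ℂ] H)) : Prop extends IsMasaBimodule D 𝒳 where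
  ternary : ∀ S ∈ 𝒳, ∀ T ∈ 𝒳, ∀ R ∈ 𝒳, S * star T * R ∈ 𝒳

end SchurIdem

open scoped Topology InnerProductSpace

namespace SchurIdem

/-! ### Invariant subspaces and cyclic subspaces of a masa. -/

section Masa
variable {H : Type*} [NormedAddCommGroup H] [InnerProductSpace ℂ H] [CompleteSpace H]
  {D : StarSubalgebra ℂ (H →L[ℂ] H)}

/-! A contractive Schur idempotent is a block-diagonal truncation. There are orthogonal
decompositions of `H` into closed subspaces `M j` and `N j` such that `Φ T` has the matrix
coefficients of `T` on `M j × N j` and zero coefficients on `M i × N j` for `i ≠ j`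
(`IsBlockDecomposition`). The range is then the set of `X` with `X (N j) ⊆ M j` for all `j`, which
makes it ternary.

The bound 2 comes from random signs. Put `Z = T - Φ T` and let `u`, `v` be finite sums of block
vectors. Multiplying each block by a sign changes `⟪u, Z v⟫` by twice its part on `S × Sᶜ` and `Sᶜ ×
S`. The range of `Φ` vanishes there, so that part is at most `α(T, ran Φ) ‖u‖ ‖v‖`. Averaged over
the signs, the modified form retains only the diagonal blocks of `Z`, which are zero; hence `‖Z‖ ≤ 2
α`. Hyperreflexivity follows because `Φ T` lies in the range.

To find the blocks, call `(η, ξ)` fixed if `⟪η, Φ A ξ⟫ = ⟪η, A ξ⟫` for all `A`. Contractivity enters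
twice. If three corners of a rectangle of vectors are fixed, so is the fourth: test `Φ` on a
Hadamard matrix (`three_corner`). Hence the spaces `rightSpace Φ η` are equal or orthogonal. And
wherever `Φ` does not vanish it has a nonzero fixed pair (`exists_fixes`). For this, the trace class
density of a functional `A ↦ ⟪y, Φ A x⟫` is carried by the conjugations `a ω ↦ a* ω` of the masa to
a compact operator in the range of `Φ` (`exists_mem_corner`). Norming functionals lower the rank to
a finite one, and an operator of minimal rank in the corner has rank one. -/

theorem IsMasa.comm (hD : IsMasa D) {A B : H →L[ℂ] H} (hA : A ∈ D) (hB : B ∈ D) :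
    A * B = B * A :=
  hD.prop A hA B hB

/-- Adjoining `A` to `D` keeps the star algebra abelian, so maximality absorbs it. -/
theorem IsMasa.mem_of_commute (hD : IsMasa D) {A : H →L[ℂ] H} (hA : IsSelfAdjoint A)
    (hc : ∀ B ∈ D, A * B = B * A) : A ∈ D := by
  have hset : ∀ x ∈ insert A (D : Set (H →L[ℂ] H)), ∀ y ∈ insert A (D : Set (H →L[ℂ] H)),
      x * y = y * x := by
    rintro x (rfl | hx) y (rfl | hy)
    · rfl
    · exact hc y hy
    · exact (hc x hx).symm
    · exact hD.comm hx hy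
  have hstar : star (insert A (D : Set (H →L[ℂ] H))) ⊆ insert A (D : Set (H →L[ℂ] H)) := by
    rintro x (hx | hx)
    · left
      rw [← star_star x, hx, hA.star_eq]
    · right
      have := star_mem (S := StarSubalgebra ℂ (H →L[ℂ] H)) (s := D) hx
      simpa using this
  have hadj := StarAlgebra.isMulCommutative_adjoin ℂ hset (fun a ha b hb =>
    hset a ha (star b) (hstar (by simpa using hb)))
  have hle : D ≤ StarAlgebra.adjoin ℂ (insert A (D : Set (H →L[ℂ] H))) := fun x hx =>
    StarAlgebra.subset_adjoin ℂ _ (Set.mem_insert_of_mem _ hx)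
  exact hD.2 (fun a ha b hb => setLike_mul_comm ha hb) hle
    (StarAlgebra.subset_adjoin ℂ _ (Set.mem_insert _ _))

/-- Since `D` is selfadjoint, `Kᗮ` is invariant along with `K`, so the projection commutes with `D`.
-/
theorem IsMasa.starProjection_mem (hD : IsMasa D) (K : Submodule ℂ H) [K.HasOrthogonalProjection]
    (hK : ∀ a ∈ D, ∀ x ∈ K, a x ∈ K) : K.starProjection ∈ D := by
  have hperp : ∀ a ∈ D, ∀ x ∈ Kᗮ, a x ∈ Kᗮ := by
    intro a ha x hx
    rw [Submodule.mem_orthogonal]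
    intro u hu
    rw [← ContinuousLinearMap.adjoint_inner_left]
    exact Submodule.inner_right_of_mem_orthogonal (hK _ (star_mem ha) u hu) hx
  refine hD.mem_of_commute (isSelfAdjoint_starProjection K) fun B hB => ?_
  ext x
  change K.starProjection (B x) = B (K.starProjection x)
  refine Submodule.eq_starProjection_of_mem_orthogonal (hK B hB _ (K.starProjection_apply_mem x)) ?_
  rw [← map_sub]
  exact hperp B hB _ (Submodule.sub_starProjection_mem_orthogonal x)

/-- Evaluation at a vector, as a linear map on the algebra `D`. -/
noncomputable def evalAt (D : StarSubalgebra ℂ (H →L[ℂ] H)) (ω : H) : D →ₗ[ℂ] H where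
  toFun a := (a : H →L[ℂ] H) ω
  map_add' _ _ := rfl
  map_smul' _ _ := rfl

/-- The cyclic subspace `closure (D ω)`. -/
noncomputable def cyc (D : StarSubalgebra ℂ (H →L[ℂ] H)) (ω : H) : Submodule ℂ H :=
  (LinearMap.range (evalAt D ω)).topologicalClosure

instance (ω : H) : CompleteSpace (cyc D ω) :=
  inferInstanceAs (CompleteSpace (LinearMap.range (evalAt D ω)).topologicalClosure)

theorem apply_mem_cyc {a : H →L[ℂ] H} (ha : a ∈ D) (ω : H) : a ω ∈ cyc D ω :=
  Submodule.le_topologicalClosure _ ⟨⟨a, ha⟩, rfl⟩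

theorem self_mem_cyc (ω : H) : ω ∈ cyc D ω := apply_mem_cyc (one_mem D) ω

/-- A closed set containing `D ω` contains the cyclic subspace. -/
theorem mem_of_mem_cyc {ω : H} {s : Set H} (hs : IsClosed s) (h : ∀ a ∈ D, a ω ∈ s) {x : H}
    (hx : x ∈ cyc D ω) : x ∈ s := by
  refine closure_minimal ?_ hs (show x ∈ closure _ from hx)
  rintro _ ⟨a, rfl⟩
  exact h a a.2

theorem cyc_invariant (ω : H) : ∀ a ∈ D, ∀ x ∈ cyc D ω, a x ∈ cyc D ω := by
  intro a ha x hx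
  refine mem_of_mem_cyc (s := a ⁻¹' (cyc D ω)) ?_ ?_ hx
  · exact (Submodule.isClosed_topologicalClosure _).preimage a.continuous
  · intro b hb
    exact apply_mem_cyc (mul_mem ha hb) ω

theorem cyc_le {ω : H} {K : Submodule ℂ H} (hK : IsClosed (K : Set H))
    (h : ∀ a ∈ D, ∀ x ∈ K, a x ∈ K) (hω : ω ∈ K) : cyc D ω ≤ K := fun _ hx =>
  mem_of_mem_cyc hK (fun a ha => h a ha ω hω) hx

theorem IsMasa.cyc_mem (hD : IsMasa D) (ω : H) : (cyc D ω).starProjection ∈ D :=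
  hD.starProjection_mem _ (cyc_invariant ω)

end Masa

/-! ### Weak* continuous functionals and their trace class densities. -/

section Normal
variable {H : Type*} [NormedAddCommGroup H] [InnerProductSpace ℂ H]

open InnerProductSpace

omit [InnerProductSpace ℂ H] in
theorem summable_norm_mul_norm {x y : ℕ → H} (hx : Summable fun n => ‖x n‖ ^ 2)
    (hy : Summable fun n => ‖y n‖ ^ 2) : Summable fun n => ‖y n‖ * ‖x n‖ := by
  refine Summable.of_nonneg_of_le (fun n => by positivity) (fun n => ?_) (hx.add hy)
  nlinarith [sq_nonneg (‖x n‖ - ‖y n‖), sq_nonneg ‖x n‖, sq_nonneg ‖y n‖]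

theorem norm_inner_apply_le (A : H →L[ℂ] H) (u v : H) : ‖⟪u, A v⟫_ℂ‖ ≤ ‖A‖ * (‖u‖ * ‖v‖) :=
  calc ‖⟪u, A v⟫_ℂ‖ ≤ ‖u‖ * ‖A v‖ := norm_inner_le_norm _ _
    _ ≤ ‖u‖ * (‖A‖ * ‖v‖) := by gcongr; exact A.le_opNorm v
    _ = _ := by ring

theorem summable_inner_apply {x y : ℕ → H} (hx : Summable fun n => ‖x n‖ ^ 2)
    (hy : Summable fun n => ‖y n‖ ^ 2) (A : H →L[ℂ] H) :
    Summable fun n => ⟪y n, A (x n)⟫_ℂ :=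
  Summable.of_norm_bounded ((summable_norm_mul_norm hx hy).mul_left ‖A‖)
    fun n => norm_inner_apply_le A (y n) (x n)

/-- Pairs of square summable sequences. -/
abbrev SqSum (H : Type*) [NormedAddCommGroup H] [InnerProductSpace ℂ H] : Type _ :=
  {p : (ℕ → H) × (ℕ → H) // (Summable fun n => ‖p.1 n‖ ^ 2) ∧ Summable fun n => ‖p.2 n‖ ^ 2}

/-- The normal functional `A ↦ ∑ ⟪yₙ, A xₙ⟫`. -/
noncomputable def normalFun (p : SqSum H) : (H →L[ℂ] H) →ₗ[ℂ] ℂ where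
  toFun A := ∑' n, ⟪p.1.2 n, A (p.1.1 n)⟫_ℂ
  map_add' A B := by
    simp only [add_apply, inner_add_right]
    exact (summable_inner_apply p.2.1 p.2.2 A).tsum_add (summable_inner_apply p.2.1 p.2.2 B)
  map_smul' c A := by
    simp only [smul_apply, inner_smul_right, RingHom.id_apply, smul_eq_mul]
    exact tsum_mul_left

theorem summable_comp_natSumNatEquivNat {E : Type*} [NormedAddCommGroup E] {x x' : ℕ → E}
    (hx : Summable fun n => ‖x n‖ ^ 2) (hx' : Summable fun n => ‖x' n‖ ^ 2) :
    Summable fun n => ‖Sum.elim x x' (Equiv.natSumNatEquivNat.symm n)‖ ^ 2 := by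
  rw [← Equiv.natSumNatEquivNat.summable_iff]
  simp only [Function.comp_def, Equiv.symm_apply_apply]
  exact Summable.sum (fun n => ‖Sum.elim x x' n‖ ^ 2) hx hx'

/-- Interleave the two pairs of sequences along `ℕ ⊕ ℕ ≃ ℕ`. -/
theorem exists_normalFun_add (p q : SqSum H) : ∃ r, normalFun r = normalFun p + normalFun q := by
  refine ⟨⟨⟨fun n => Sum.elim p.1.1 q.1.1 (Equiv.natSumNatEquivNat.symm n),
    fun n => Sum.elim p.1.2 q.1.2 (Equiv.natSumNatEquivNat.symm n)⟩,
    summable_comp_natSumNatEquivNat p.2.1 q.2.1, summable_comp_natSumNatEquivNat p.2.2 q.2.2⟩, ?_⟩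
  ext A
  simp only [normalFun, LinearMap.coe_mk, AddHom.coe_mk, LinearMap.add_apply]
  rw [← Equiv.natSumNatEquivNat.tsum_eq]
  simp only [Equiv.symm_apply_apply]
  rw [Summable.tsum_sum]
  · rfl
  · exact summable_inner_apply p.2.1 p.2.2 A
  · exact summable_inner_apply q.2.1 q.2.2 A

theorem exists_normalFun_smul (c : ℂ) (p : SqSum H) : ∃ r, normalFun r = c • normalFun p := by
  refine ⟨⟨⟨fun n => c • p.1.1 n, p.1.2⟩, ?_, p.2.2⟩, ?_⟩
  · simp only [norm_smul, mul_pow]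
    exact p.2.1.mul_left _
  · ext A
    simp only [normalFun, LinearMap.coe_mk, AddHom.coe_mk, map_smul, inner_smul_right,
      LinearMap.smul_apply, smul_eq_mul]
    exact tsum_mul_left

/-- The weak* topology is initial for the functionals `normalFun p`, so a continuous functional lies
in their span, and these functionals already form a subspace. -/
theorem exists_normalFun_eq {g : (H →L[ℂ] H) →ₗ[ℂ] ℂ}
    (hg : Continuous[weakStar H, inferInstance] g) : ∃ p, g = normalFun p := by
  have h1 : Continuous[⨅ p : SqSum H, TopologicalSpace.induced (normalFun p) inferInstance,
      inferInstance] g := by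
    refine continuous_le_dom ?_ hg
    refine le_iInf fun x => le_iInf fun y => le_iInf fun hx => le_iInf fun hy => ?_
    exact iInf_le (fun p : SqSum H => TopologicalSpace.induced (normalFun p) inferInstance)
      ⟨⟨x, y⟩, hx, hy⟩
  rw [← LinearMap.mem_span_iff_continuous] at h1
  refine Submodule.span_induction (p := fun g _ => ∃ p, g = normalFun p) ?_ ?_ ?_ ?_ h1
  · rintro _ ⟨p, rfl⟩
    exact ⟨p, rfl⟩
  · exact ⟨⟨⟨0, 0⟩, by simp [summable_zero], by simp [summable_zero]⟩, by ext; simp [normalFun]⟩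
  · rintro _ _ _ _ ⟨p, rfl⟩ ⟨q, rfl⟩
    obtain ⟨r, hr⟩ := exists_normalFun_add p q
    exact ⟨r, hr.symm⟩
  · rintro c _ _ ⟨p, rfl⟩
    obtain ⟨r, hr⟩ := exists_normalFun_smul c p
    exact ⟨r, hr.symm⟩

theorem continuous_inner_apply (u v : H) :
    Continuous[weakStar H, inferInstance] fun A : H →L[ℂ] H => ⟪u, A v⟫_ℂ := by
  have hs : ∀ w : H, Summable fun n : ℕ => ‖(Pi.single 0 w : ℕ → H) n‖ ^ 2 := fun w =>
    summable_of_ne_finset_zero (s := {0}) fun n hn => by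
      rw [Finset.mem_singleton] at hn
      simp [Pi.single_eq_of_ne hn]
  have h : (fun A : H →L[ℂ] H => ⟪u, A v⟫_ℂ) = fun A : H →L[ℂ] H =>
      ∑' n, ⟪(Pi.single 0 u : ℕ → H) n, A ((Pi.single 0 v : ℕ → H) n)⟫_ℂ := by
    ext A
    rw [tsum_eq_single 0]
    · simp
    · intro n hn
      simp [Pi.single_eq_of_ne hn]
  rw [h]
  refine continuous_le_dom ?_ (continuous_induced_dom)
  exact iInf_le_of_le (Pi.single 0 v) (iInf_le_of_le (Pi.single 0 u)
    (iInf_le_of_le (hs v) (iInf_le_of_le (hs u) le_rfl)))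

theorem summable_rankOne (p : SqSum H) :
    Summable fun n => ‖rankOne ℂ (p.1.2 n) (p.1.1 n)‖ := by
  simpa using summable_norm_mul_norm p.2.1 p.2.2

/-- The trace class operator `∑ yₙ ⊗ xₙ*` representing `normalFun`. -/
noncomputable def density (p : SqSum H) : H →L[ℂ] H := ∑' n, rankOne ℂ (p.1.2 n) (p.1.1 n)

variable [CompleteSpace H]

theorem hasSum_density (p : SqSum H) :
    HasSum (fun n => rankOne ℂ (p.1.2 n) (p.1.1 n)) (density p) :=
  (summable_rankOne p).of_norm.hasSum

omit [CompleteSpace H] in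
theorem isCompactOperator_rankOne (u v : H) : IsCompactOperator (rankOne ℂ u v) := by
  rw [rankOne_def']
  exact (isCompactOperator_of_locallyCompactSpace_dom
    (innerSL ℂ v)).clm_comp (ContinuousLinearMap.toSpanSingleton ℂ u)

theorem isCompactOperator_density (p : SqSum H) : IsCompactOperator (density p) := by
  refine isCompactOperator_of_tendsto (hasSum_density p) (Filter.Eventually.of_forall fun s => ?_)
  exact (compactOperator (RingHom.id ℂ) H H).sum_mem fun i _ => isCompactOperator_rankOne _ _

theorem normalFun_rankOne (p : SqSum H) (u v : H) :
    normalFun p (rankOne ℂ u v) = ⟪density p v, u⟫_ℂ := by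
  have h := ((hasSum_density p).mapL (ContinuousLinearMap.apply ℂ H v)).mapL (innerSL ℂ u)
  have h2 := Complex.hasSum_conj'.mpr h
  simp only [ContinuousLinearMap.apply_apply, innerSL_apply_apply, inner_conj_symm] at h2
  rw [← h2.tsum_eq]
  simp only [normalFun, LinearMap.coe_mk, AddHom.coe_mk]
  refine tsum_congr fun n => ?_
  simp [inner_smul_left]

omit [CompleteSpace H] in
theorem hilbertBasis_norm_sum_le {ι : Type*} (b : HilbertBasis ι ℂ H) (s : Finset ι) (y : H) :
    ‖∑ i ∈ s, ⟪b i, y⟫_ℂ • b i‖ ≤ ‖y‖ := by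
  refine le_of_sq_le_sq ?_ (norm_nonneg _)
  have h := b.orthonormal.sum_inner_products_le y (s := s)
  refine le_trans (le_of_eq ?_) h
  have h1 := b.orthonormal.inner_sum (fun i => ⟪b i, y⟫_ℂ) (fun i => ⟪b i, y⟫_ℂ) s
  rw [inner_self_eq_norm_sq_to_K] at h1
  have h2 : ((‖∑ i ∈ s, ⟪b i, y⟫_ℂ • b i‖ ^ 2 : ℝ) : ℂ) = ((∑ i ∈ s, ‖⟪b i, y⟫_ℂ‖ ^ 2 : ℝ) : ℂ) := by
    push_cast
    rw [← Complex.coe_algebraMap, h1]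
    exact Finset.sum_congr rfl fun i _ => Complex.conj_mul' _
  exact_mod_cast h2

/-- The density determines the functional on rank one operators. A general `A` is reached through
the finite rank operators `P_s A`, with `P_s` the projection onto finitely many basis vectors, and
dominated convergence in `s`. -/
theorem normalFun_eq_zero {p : SqSum H} (h : density p = 0) : normalFun p = 0 := by
  ext A
  obtain ⟨w, b, -⟩ := exists_hilbertBasis ℂ H
  have h0 : ∀ s : Finset w, ∑' n, ⟪∑ i ∈ s, ⟪b i, p.1.2 n⟫_ℂ • b i, A (p.1.1 n)⟫_ℂ = 0 := by
    intro s
    have h1 : normalFun p (∑ i ∈ s, rankOne ℂ (b i) (A.adjoint (b i))) = 0 := by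
      rw [map_sum]
      exact Finset.sum_eq_zero fun i _ => by rw [normalFun_rankOne, h]; simp
    rw [← h1]
    simp only [normalFun, LinearMap.coe_mk, AddHom.coe_mk]
    refine tsum_congr fun n => ?_
    simp only [sum_inner, sum_apply, inner_sum, rankOne_apply,
      inner_smul_left, inner_smul_right, ContinuousLinearMap.adjoint_inner_left, inner_conj_symm]
    exact Finset.sum_congr rfl fun i _ => mul_comm _ _
  have ht := tendsto_tsum_of_dominated_convergence (𝓕 := (Filter.atTop : Filter (Finset w)))
    (f := fun s n => ⟪∑ i ∈ s, ⟪b i, p.1.2 n⟫_ℂ • b i, A (p.1.1 n)⟫_ℂ)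
    (g := fun n => ⟪p.1.2 n, A (p.1.1 n)⟫_ℂ)
    ((summable_norm_mul_norm p.2.1 p.2.2).mul_left ‖A‖)
    (fun n => by
      have := b.hasSum_repr (p.1.2 n)
      simp only [b.repr_apply_apply] at this
      exact Filter.Tendsto.inner this tendsto_const_nhds)
    (Filter.Eventually.of_forall fun s n => by
      refine (norm_inner_apply_le A _ _).trans ?_
      gcongr
      exact hilbertBasis_norm_sum_le b s _)
  simp only [h0] at ht
  exact tendsto_nhds_unique ht tendsto_const_nhds

end Normal

/-! ### The conjugation of a cyclic subspace, and compact operators in the range. -/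

section Conjugation
variable {H : Type*} [NormedAddCommGroup H] [InnerProductSpace ℂ H] [CompleteSpace H]
  {D : StarSubalgebra ℂ (H →L[ℂ] H)}

open InnerProductSpace

theorem star_inner_left (a : H →L[ℂ] H) (u v : H) : ⟪(star a) u, v⟫_ℂ = ⟪u, a v⟫_ℂ :=
  ContinuousLinearMap.adjoint_inner_left a v u

theorem star_inner_right (a : H →L[ℂ] H) (u v : H) : ⟪u, (star a) v⟫_ℂ = ⟪a u, v⟫_ℂ :=
  ContinuousLinearMap.adjoint_inner_right a u v

/-- The map `a ↦ a* ω`. -/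
noncomputable def starEvalAt (D : StarSubalgebra ℂ (H →L[ℂ] H)) (ω : H) : D →ₗ⋆[ℂ] H where
  toFun a := (star (a : H →L[ℂ] H)) ω
  map_add' a b := by simp
  map_smul' c a := by simp

/-- The map `a ↦ a ω` into the cyclic subspace. -/
noncomputable def evalCyc (D : StarSubalgebra ℂ (H →L[ℂ] H)) (ω : H) : D →ₗ[ℂ] cyc D ω :=
  (evalAt D ω).codRestrict (cyc D ω) fun a => apply_mem_cyc a.2 ω

/-- The conjugate-linear map with `a ω ↦ a* ω` for `a ∈ D`, vanishing on the orthogonal complement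
of the cyclic subspace of `ω`. -/
noncomputable def conj (D : StarSubalgebra ℂ (H →L[ℂ] H)) (ω : H) : H →L⋆[ℂ] H :=
  ((starEvalAt D ω).extendOfNorm (evalCyc D ω)).comp (cyc D ω).orthogonalProjectionOnto

theorem denseRange_evalCyc (ω : H) : DenseRange (evalCyc D ω) := by
  rintro ⟨x, hx⟩
  rw [closure_subtype]
  refine mem_of_mem_cyc (D := D) (ω := ω) isClosed_closure (fun a ha => subset_closure ?_) hx
  exact ⟨⟨a ω, apply_mem_cyc ha ω⟩, ⟨⟨a, ha⟩, rfl⟩, rfl⟩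

variable (hD : IsMasa D)
include hD

/-- Elements of the abelian algebra `D` are normal. This makes `a ω ↦ a* ω` well defined and
isometric. -/
theorem norm_star_apply {a : H →L[ℂ] H} (ha : a ∈ D) (ω : H) : ‖(star a) ω‖ = ‖a ω‖ := by
  have h : ⟪(star a) ω, (star a) ω⟫_ℂ = ⟪a ω, a ω⟫_ℂ := by
    rw [star_inner_left, ← mul_apply_eq_comp, hD.comm ha (star_mem ha), mul_apply_eq_comp,
      star_inner_right]
  rw [inner_self_eq_norm_sq_to_K, inner_self_eq_norm_sq_to_K] at h
  have h2 : ‖(star a) ω‖ ^ 2 = ‖a ω‖ ^ 2 := by exact_mod_cast h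
  exact (sq_eq_sq₀ (norm_nonneg _) (norm_nonneg _)).mp h2

theorem conj_apply {a : H →L[ℂ] H} (ha : a ∈ D) (ω : H) : conj D ω (a ω) = (star a) ω := by
  have h1 : (cyc D ω).orthogonalProjectionOnto (a ω) = evalCyc D ω ⟨a, ha⟩ :=
    Submodule.orthogonalProjectionOnto_mem_subspace_eq_self ⟨a ω, apply_mem_cyc ha ω⟩
  rw [conj, ContinuousLinearMap.comp_apply, h1, LinearMap.extendOfNorm_eq (denseRange_evalCyc ω)]
  · rfl
  · refine ⟨1, fun b => ?_⟩
    rw [one_mul]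
    exact (norm_star_apply hD b.2 ω).le

omit hD in
theorem conj_starProjection (ω v : H) : conj D ω ((cyc D ω).starProjection v) = conj D ω v := by
  rw [conj, ContinuousLinearMap.comp_apply, ContinuousLinearMap.comp_apply]
  congr 1
  exact Submodule.orthogonalProjectionOnto_mem_subspace_eq_self _

theorem conj_mem (ω v : H) : conj D ω v ∈ cyc D ω := by
  rw [← conj_starProjection]
  refine mem_of_mem_cyc (D := D) (ω := ω) (s := conj D ω ⁻¹' (cyc D ω)) ?_ (fun a ha => ?_)
    ((cyc D ω).starProjection_apply_mem v)
  · exact (Submodule.isClosed_topologicalClosure _).preimage (conj D ω).continuous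
  · have h : (star a) ω ∈ cyc D ω := apply_mem_cyc (star_mem ha) ω
    rwa [← conj_apply hD ha] at h

theorem conj_conj (ω v : H) : conj D ω (conj D ω v) = (cyc D ω).starProjection v := by
  rw [← conj_starProjection ω v]
  refine mem_of_mem_cyc (D := D) (ω := ω) (s := {x | conj D ω (conj D ω x) = x}) ?_
    (fun a ha => ?_) ((cyc D ω).starProjection_apply_mem v)
  · exact isClosed_eq (by fun_prop) continuous_id
  · rw [Set.mem_ofPred_eq, conj_apply hD ha, conj_apply hD (star_mem ha), star_star]

/-- On `D ω` both sides equal `⟪ω, a b ω⟫` up to the order of `a` and `b`; density does the rest. -/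
theorem inner_conj_swap (ω u v : H) : ⟪conj D ω u, v⟫_ℂ = ⟪conj D ω v, u⟫_ℂ := by
  have key : ∀ x ∈ cyc D ω, ∀ y ∈ cyc D ω, ⟪conj D ω x, y⟫_ℂ = ⟪conj D ω y, x⟫_ℂ := by
    intro x hx y hy
    refine mem_of_mem_cyc (D := D) (ω := ω) (s := {x | ⟪conj D ω x, y⟫_ℂ = ⟪conj D ω y, x⟫_ℂ})
      (isClosed_eq (by fun_prop) (by fun_prop)) (fun a ha => ?_) hx
    refine mem_of_mem_cyc (D := D) (ω := ω)
      (s := {y | ⟪conj D ω (a ω), y⟫_ℂ = ⟪conj D ω y, a ω⟫_ℂ})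
      (isClosed_eq (by fun_prop) (by fun_prop)) (fun b hb => ?_) hy
    rw [Set.mem_ofPred_eq, conj_apply hD ha, conj_apply hD hb, star_inner_left, star_inner_left,
      ← mul_apply_eq_comp, hD.comm ha hb, mul_apply_eq_comp]
  have h : ∀ x y, ⟪conj D ω x, y⟫_ℂ
      = ⟪conj D ω ((cyc D ω).starProjection x), (cyc D ω).starProjection y⟫_ℂ := by
    intro x y
    rw [conj_starProjection, ← Submodule.inner_starProjection_left_eq_right,
      Submodule.starProjection_eq_self_iff.mpr (conj_mem hD ω x)]
  rw [h u v, h v u]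
  exact key _ (Submodule.starProjection_apply_mem _ _) _ (Submodule.starProjection_apply_mem _ _)

theorem inner_conj_conj (ω u v : H) :
    ⟪conj D ω u, conj D ω v⟫_ℂ = ⟪(cyc D ω).starProjection v, u⟫_ℂ := by
  rw [inner_conj_swap hD, conj_conj hD]

variable {Φ : (H →L[ℂ] H) →ₗ[ℂ] (H →L[ℂ] H)}

omit hD in
theorem rankOne_apply_apply (a b : H →L[ℂ] H) (u v : H) :
    rankOne ℂ (a u) (b v) = a * rankOne ℂ u v * star b := by
  ext z
  simp [star_inner_right]

omit [CompleteSpace H] hD in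
theorem IsContractive.continuous (hc : IsContractive Φ) : Continuous Φ :=
  AddMonoidHomClass.continuous_of_bound Φ 1 fun T => by simpa using hc T

/-- The symmetry of the symbol of a bimodule map: on rank one operators, matrix coefficients can be
exchanged with the input vectors. -/
theorem inner_map_rankOne (hΦ : IsSchurMultiplier D Φ) (hc : Continuous Φ) {ω₁ ω₂ u v x y : H}
    (hu : u ∈ cyc D ω₁) (hy : y ∈ cyc D ω₁) (hv : v ∈ cyc D ω₂) (hx : x ∈ cyc D ω₂) :
    ⟪y, Φ (rankOne ℂ u v) x⟫_ℂ =
      ⟪conj D ω₁ u, Φ (rankOne ℂ (conj D ω₁ y) (conj D ω₂ x)) (conj D ω₂ v)⟫_ℂ := by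
  have h1 : ∀ w z : H, Continuous fun u : H => Φ (rankOne ℂ u w) z := fun w z =>
    (ContinuousLinearMap.apply ℂ H z).continuous.comp (hc.comp (by fun_prop))
  have h2 : ∀ w z : H, Continuous fun u : H => Φ (rankOne ℂ w u) z := fun w z =>
    (ContinuousLinearMap.apply ℂ H z).continuous.comp (hc.comp (by fun_prop))
  refine mem_of_mem_cyc (D := D) (ω := ω₁) (s := {u | ⟪y, Φ (rankOne ℂ u v) x⟫_ℂ =
      ⟪conj D ω₁ u, Φ (rankOne ℂ (conj D ω₁ y) (conj D ω₂ x)) (conj D ω₂ v)⟫_ℂ})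
    (isClosed_eq (continuous_const.inner (h1 _ _)) (by fun_prop)) (fun a ha => ?_) hu
  refine mem_of_mem_cyc (D := D) (ω := ω₁) (s := {y | ⟪y, Φ (rankOne ℂ (a ω₁) v) x⟫_ℂ =
      ⟪conj D ω₁ (a ω₁), Φ (rankOne ℂ (conj D ω₁ y) (conj D ω₂ x)) (conj D ω₂ v)⟫_ℂ})
    (isClosed_eq (by fun_prop) (continuous_const.inner ((h1 _ _).comp (conj D ω₁).continuous)))
    (fun d hd => ?_) hy
  refine mem_of_mem_cyc (D := D) (ω := ω₂) (s := {v | ⟪d ω₁, Φ (rankOne ℂ (a ω₁) v) x⟫_ℂ =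
      ⟪conj D ω₁ (a ω₁), Φ (rankOne ℂ (conj D ω₁ (d ω₁)) (conj D ω₂ x)) (conj D ω₂ v)⟫_ℂ})
    (isClosed_eq (continuous_const.inner (h2 _ _)) (by fun_prop)) (fun b hb => ?_) hv
  refine mem_of_mem_cyc (D := D) (ω := ω₂) (s := {x | ⟪d ω₁, Φ (rankOne ℂ (a ω₁) (b ω₂)) x⟫_ℂ =
      ⟪conj D ω₁ (a ω₁), Φ (rankOne ℂ (conj D ω₁ (d ω₁)) (conj D ω₂ x)) (conj D ω₂ (b ω₂))⟫_ℂ})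
    (isClosed_eq (by fun_prop) (continuous_const.inner ((h2 _ _).comp (conj D ω₂).continuous)))
    (fun c hc' => ?_) hx
  -- By density the vectors are now `a ω₁`, `d ω₁`, `b ω₂`, `c ω₂`. The sides are coefficients at
  -- `(ω₁, ω₂)` of `d* a Φ(ω₁ ⊗ ω₂*) b* c` and `a d* Φ(ω₁ ⊗ ω₂*) c b*`, equal because `D` is
  -- abelian.
  rw [Set.mem_ofPred_eq, conj_apply hD ha, conj_apply hD hd, conj_apply hD hb, conj_apply hD hc',
    rankOne_apply_apply, rankOne_apply_apply, hΦ.bimodule_map _ ha _ (star_mem hb),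
    hΦ.bimodule_map _ (star_mem hd) _ (star_mem (star_mem hc')), star_star, star_inner_left,
    ← star_inner_right, ← mul_apply_eq_comp, ← mul_apply_eq_comp,
    ← mul_apply_eq_comp, ← mul_apply_eq_comp]
  congr 2
  have e1 := hD.comm ha (star_mem hd)
  have e2 := hD.comm hc' (star_mem hb)
  calc star d * (a * Φ (rankOne ℂ ω₁ ω₂) * star b * c)
      = (star d * a) * Φ (rankOne ℂ ω₁ ω₂) * (star b * c) := by simp only [mul_assoc]
    _ = _ := by rw [← e1, ← e2]; simp only [mul_assoc]

/-- The range of `Φ`, compressed to the cyclic subspaces of two vectors. -/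
def corner (D : StarSubalgebra ℂ (H →L[ℂ] H)) (Φ : (H →L[ℂ] H) →ₗ[ℂ] (H →L[ℂ] H)) (ω₁ ω₂ : H) :
    Set (H →L[ℂ] H) :=
  {T | Φ T = T ∧ (cyc D ω₁).starProjection * T * (cyc D ω₂).starProjection = T}

/-- Conjugating the density of a functional `A ↦ ⟪y, Φ A x⟫` produces an element of the range. -/
theorem exists_mem_corner (hΦ : IsSchurIdempotent D Φ) (hc : IsContractive Φ) {ω₁ ω₂ x y : H}
    (hy : y ∈ cyc D ω₁) (hx : x ∈ cyc D ω₂) (hne : ∃ A, ⟪y, Φ A x⟫_ℂ ≠ 0) :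
    ∃ R ∈ corner D Φ ω₁ ω₂, R ≠ 0 ∧ IsCompactOperator R ∧
      ∃ S : H →L[ℂ] H, (∀ u v, ⟪y, Φ (rankOne ℂ u v) x⟫_ℂ = ⟪S v, u⟫_ℂ) ∧
        ∀ v, R v ∈ (LinearMap.range (S : H →ₗ[ℂ] H)).map (conj D ω₁ : H →ₗ⋆[ℂ] H) := by
  let p := (cyc D ω₁).starProjection
  let q := (cyc D ω₂).starProjection
  have hp : p ∈ D := hD.cyc_mem ω₁
  have hq : q ∈ D := hD.cyc_mem ω₂
  let g : (H →L[ℂ] H) →ₗ[ℂ] ℂ :=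
    (innerSL ℂ y).toLinearMap ∘ₗ (ContinuousLinearMap.apply ℂ H x).toLinearMap ∘ₗ Φ
  have hgapp : ∀ A, g A = ⟪y, Φ A x⟫_ℂ := fun A => rfl
  have hg : Continuous[weakStar H, inferInstance] g :=
    @Continuous.comp _ _ _ (weakStar H) (weakStar H) _ (⇑Φ) (fun A => ⟪y, A x⟫_ℂ)
      (continuous_inner_apply y x) hΦ.weakStar_continuous
  obtain ⟨s, hs⟩ := exists_normalFun_eq hg
  have hpy : p y = y := Submodule.starProjection_eq_self_iff.mpr hy
  have hqx : q x = x := Submodule.starProjection_eq_self_iff.mpr hx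
  have hpsymm : ∀ u v, ⟪p u, v⟫_ℂ = ⟪u, p v⟫_ℂ := Submodule.inner_starProjection_left_eq_right _
  have hqsymm : ∀ u v, ⟪q u, v⟫_ℂ = ⟪u, q v⟫_ℂ := Submodule.inner_starProjection_left_eq_right _
  have hpp : p * p = p := Submodule.isIdempotentElem_starProjection _
  have hqq : q * q = q := Submodule.isIdempotentElem_starProjection _
  have hgpq : ∀ A, g (p * A * q) = g A := by
    intro A
    rw [hgapp, hΦ.bimodule_map p hp q hq]
    change ⟪y, p (Φ A (q x))⟫_ℂ = _
    rw [← hpsymm, hpy, hqx, hgapp]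
  have hgΦ : ∀ A, g (Φ A) = g A := fun A => by
    rw [hgapp, hgapp, ← LinearMap.comp_apply, hΦ.idempotent]
  let S := density s
  have hS : ∀ u v, g (rankOne ℂ u v) = ⟪S v, u⟫_ℂ := fun u v => by rw [hs, normalFun_rankOne]
  have hpSq : p * S * q = S := by
    ext v
    refine ext_inner_right ℂ fun u => ?_
    rw [← hS, ← hgpq]
    have : p * rankOne ℂ u v * q = rankOne ℂ (p u) (q v) := by
      ext z; simp [hqsymm]
    rw [this, hS, ← hpsymm]
    rfl
  let R : H →L[ℂ] H := ((conj D ω₁).comp S).comp (conj D ω₂)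
  have hRapp : ∀ v, R v = conj D ω₁ (S (conj D ω₂ v)) := fun v => rfl
  have hpR : p * R * q = R := by
    ext v
    change p (conj D ω₁ (S (conj D ω₂ (q v)))) = conj D ω₁ (S (conj D ω₂ v))
    rw [conj_starProjection]
    exact Submodule.starProjection_eq_self_iff.mpr (conj_mem hD _ _)
  have hRsum : HasSum (fun n => rankOne ℂ (conj D ω₁ (s.1.2 n)) (conj D ω₂ (s.1.1 n))) R := by
    let Ψ : (H →L[ℂ] H) →+ (H →L[ℂ] H) :=
      { toFun := fun A => ((conj D ω₁).comp A).comp (conj D ω₂)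
        map_zero' := by ext; simp
        map_add' := fun A B => by ext; simp }
    have hΨ : Continuous Ψ := by
      refine AddMonoidHomClass.continuous_of_bound Ψ (‖conj D ω₁‖ * ‖conj D ω₂‖) fun A => ?_
      calc ‖((conj D ω₁).comp A).comp (conj D ω₂)‖
          ≤ ‖conj D ω₁‖ * ‖A‖ * ‖conj D ω₂‖ :=
            (ContinuousLinearMap.opNorm_comp_le _ _).trans
              (mul_le_mul_of_nonneg_right (ContinuousLinearMap.opNorm_comp_le _ _) (norm_nonneg _))
        _ = _ := by ring
    refine ((hasSum_density s).map Ψ hΨ).congr_fun fun n => ?_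
    ext z
    change ⟪conj D ω₂ (s.1.1 n), z⟫_ℂ • conj D ω₁ (s.1.2 n)
      = conj D ω₁ (⟪s.1.1 n, conj D ω₂ z⟫_ℂ • s.1.2 n)
    rw [map_smulₛₗ, inner_conj_symm, inner_conj_swap hD]
  refine ⟨R, ⟨?_, hpR⟩, ?_, ?_, S, fun u v => by rw [← hgapp, hS], fun v => ?_⟩
  -- With `g A = ⟪y, Φ A x⟫`, expand `R` in rank one operators and apply `inner_map_rankOne`
  -- termwise. The sum becomes `g (Φ (p u ⊗ (q v)*))`. Idempotence gives `g ∘ Φ = g`, and `g (p u ⊗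
  -- (q v)*)` is the corresponding coefficient of `R`.
  · have h1 : ∀ u v, ⟪conj D ω₁ u, Φ R (conj D ω₂ v)⟫_ℂ = ⟪conj D ω₁ u, R (conj D ω₂ v)⟫_ℂ := by
      intro u v
      have e1 := (((hRsum.map Φ hc.continuous).mapL
        (ContinuousLinearMap.apply ℂ H (conj D ω₂ v))).mapL (innerSL ℂ (conj D ω₁ u))).tsum_eq
      change ∑' n, ⟪conj D ω₁ u, Φ (rankOne ℂ (conj D ω₁ (s.1.2 n)) (conj D ω₂ (s.1.1 n)))
        (conj D ω₂ v)⟫_ℂ = ⟪conj D ω₁ u, Φ R (conj D ω₂ v)⟫_ℂ at e1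
      have hmem1 : p u ∈ cyc D ω₁ := Submodule.starProjection_apply_mem _ _
      have hmem2 : q v ∈ cyc D ω₂ := Submodule.starProjection_apply_mem _ _
      have hpq : p * rankOne ℂ (p u) (q v) * q = rankOne ℂ (p u) (q v) := by
        ext z
        change p (⟪q v, q z⟫_ℂ • p u) = ⟪q v, z⟫_ℂ • p u
        rw [map_smul, ← hqsymm, ← mul_apply_eq_comp q, hqq, ← mul_apply_eq_comp p, hpp]
      have e2 : ∀ n, ⟪conj D ω₁ u, Φ (rankOne ℂ (conj D ω₁ (s.1.2 n)) (conj D ω₂ (s.1.1 n)))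
          (conj D ω₂ v)⟫_ℂ = ⟪s.1.2 n, Φ (rankOne ℂ (p u) (q v)) (s.1.1 n)⟫_ℂ := by
        intro n
        rw [← conj_starProjection ω₁ u, ← conj_starProjection ω₂ v,
          ← conj_starProjection ω₁ (s.1.2 n), ← conj_starProjection ω₂ (s.1.1 n),
          ← inner_map_rankOne hD hΦ.toIsSchurMultiplier hc.continuous hmem1
            (Submodule.starProjection_apply_mem _ _) hmem2 (Submodule.starProjection_apply_mem _ _)]
        change ⟪p (s.1.2 n), Φ (rankOne ℂ (p u) (q v)) (q (s.1.1 n))⟫_ℂ = _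
        rw [hpsymm]
        nth_rw 2 [← hpq]
        rw [hΦ.bimodule_map p hp q hq]
        rfl
      rw [← e1, tsum_congr e2]
      change normalFun s (Φ (rankOne ℂ (p u) (q v))) = _
      rw [← hs, hgΦ, hS, hRapp, conj_conj hD, inner_conj_conj hD, ← hpsymm]
    rw [← sub_eq_zero]
    have h2 : p * (Φ R - R) * q = Φ R - R := by
      rw [mul_sub, sub_mul, hpR, ← hΦ.bimodule_map p hp q hq, hpR]
    ext b
    refine ext_inner_left ℂ fun a => ?_
    rw [← h2]
    change ⟪a, p ((Φ R - R) (q b))⟫_ℂ = ⟪a, 0⟫_ℂ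
    rw [← hpsymm, ← conj_conj hD, ← conj_conj hD, sub_apply, inner_sub_right, h1, sub_self]
    simp
  -- Both conjugations can be undone on the cyclic subspaces, so `R = 0` would force `S = 0` and
  -- then `g = 0`.
  · intro h0
    obtain ⟨A, hA⟩ := hne
    refine hA ?_
    rw [← hgapp, hs, normalFun_eq_zero, LinearMap.zero_apply]
    change S = 0
    rw [← hpSq]
    ext v
    change p (S (q v)) = 0
    rw [← conj_conj hD, ← conj_conj hD, ← hRapp, h0, zero_apply, map_zero]
  · exact ((isCompactOperator_density s).clm_comp (conj D ω₁)).comp_clm (conj D ω₂)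
  · exact ⟨_, ⟨_, rfl⟩, rfl⟩

end Conjugation

/-! ### Functionals norming a contraction; norm attainment of compact operators. -/

section Norming
variable {H : Type*} [NormedAddCommGroup H] [InnerProductSpace ℂ H] [CompleteSpace H]

open InnerProductSpace

/-- A perturbation by `(1 - T T*) w` has no first order effect on the norm bound. With `y = T* w`,
contractivity at `x - y` controls the cross term at the cost of `‖y‖² ≤ ‖w‖²`, and `‖w - T y‖² ≤ 4
‖w‖²`; hence the 5. -/
theorem norm_apply_add_defect_sq_le {T : H →L[ℂ] H} (hT : ‖T‖ ≤ 1) (x w : H) :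
    ‖T x + (w - T ((star T) w))‖ ^ 2 ≤ ‖x‖ ^ 2 + 5 * ‖w‖ ^ 2 := by
  have hTn : ∀ z, ‖T z‖ ≤ ‖z‖ := fun z => T.le_of_opNorm_le_of_le hT le_rfl |>.trans (by simp)
  have hT' : ‖star T‖ ≤ 1 := by rwa [norm_star]
  have hy : ‖(star T) w‖ ≤ ‖w‖ := (star T).le_of_opNorm_le_of_le hT' le_rfl |>.trans (by simp)
  set y := (star T) w with hydef
  have h1 : ‖T (x - y)‖ ^ 2 ≤ ‖x - y‖ ^ 2 := by gcongr; exact hTn _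
  rw [map_sub, @norm_sub_sq ℂ, @norm_sub_sq ℂ] at h1
  have h2 : ⟪T x, w - T y⟫_ℂ = ⟪x, y⟫_ℂ - ⟪T x, T y⟫_ℂ := by
    rw [inner_sub_right, hydef, star_inner_right]
  rw [@norm_add_sq ℂ, h2, map_sub]
  have h3 : ‖w - T y‖ ≤ 2 * ‖w‖ := by
    calc ‖w - T y‖ ≤ ‖w‖ + ‖T y‖ := norm_sub_le _ _
      _ ≤ ‖w‖ + ‖w‖ := by gcongr; exact (hTn y).trans hy
      _ = _ := by ring
  have h4 : ‖w - T y‖ ^ 2 ≤ (2 * ‖w‖) ^ 2 := by gcongr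
  have h5 : ‖y‖ ^ 2 ≤ ‖w‖ ^ 2 := by gcongr
  nlinarith [sq_nonneg ‖T y‖]

/-- A functional norming a contraction `T` is concentrated on the eigenspace `T T* = 1`. -/
theorem norming_left {f : (H →L[ℂ] H) →ₗ[ℂ] ℂ} (hf : ∀ A, ‖f A‖ ≤ ‖A‖) {T : H →L[ℂ] H}
    (hT : ‖T‖ ≤ 1) (hfT : f T = 1) (A : H →L[ℂ] H) : f (T * star T * A) = f A := by
  suffices h : f (A - T * star T * A) = 0 by
    rw [map_sub, sub_eq_zero] at h
    exact h.symm
  set B := A - T * star T * A with hB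
  have hn : ∀ z : ℂ, ‖T + z • B‖ ^ 2 ≤ 1 + 5 * (‖z‖ * ‖A‖) ^ 2 := by
    intro z
    have hle : ‖T + z • B‖ ≤ √(1 + 5 * (‖z‖ * ‖A‖) ^ 2) := by
      refine ContinuousLinearMap.opNorm_le_bound _ (Real.sqrt_nonneg _) fun x => ?_
      refine le_of_sq_le_sq ?_ (by positivity)
      rw [mul_pow, Real.sq_sqrt (by positivity)]
      have e : (T + z • B) x = T x + (z • A x - T ((star T) (z • A x))) := by
        rw [hB]
        change T x + z • (A x - T ((star T) (A x))) = _
        rw [map_smul, map_smul, smul_sub]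
      rw [e]
      refine (norm_apply_add_defect_sq_le hT _ _).trans ?_
      have h6 : ‖z • A x‖ ≤ ‖z‖ * ‖A‖ * ‖x‖ := by
        rw [norm_smul, mul_assoc]
        gcongr
        exact A.le_opNorm x
      have h7 : ‖z • A x‖ ^ 2 ≤ (‖z‖ * ‖A‖ * ‖x‖) ^ 2 := by gcongr
      nlinarith
    calc ‖T + z • B‖ ^ 2 ≤ √(1 + 5 * (‖z‖ * ‖A‖) ^ 2) ^ 2 := by gcongr
      _ = _ := Real.sq_sqrt (by positivity)
  by_contra hne
  have hpos : 0 < ‖f B‖ ^ 2 := by positivity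
  -- For `z = t · conj (f B)` the value of `f` at `T + z B` is `1 + t ‖f B‖²`, linear in `t`, while
  -- `hn` allows the squared norm to grow only quadratically. A small `t` gives the contradiction.
  obtain ⟨t, ht, htC⟩ : ∃ t : ℝ, 0 < t ∧ 5 * ‖A‖ ^ 2 * t ≤ 1 :=
    ⟨1 / (5 * ‖A‖ ^ 2 + 1), by positivity, by
      rw [mul_one_div, div_le_one (by positivity)]; linarith⟩
  have h1 := hn (t * (starRingEnd ℂ) (f B))
  have h2 : f (T + ((t : ℂ) * (starRingEnd ℂ) (f B)) • B) = ((1 + t * ‖f B‖ ^ 2 : ℝ) : ℂ) := by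
    rw [map_add, map_smul, hfT, smul_eq_mul, mul_assoc, Complex.conj_mul']
    push_cast
    rfl
  have h3 := hf (T + ((t : ℂ) * (starRingEnd ℂ) (f B)) • B)
  rw [h2, Complex.norm_real, Real.norm_of_nonneg (by positivity)] at h3
  have h4 : (1 + t * ‖f B‖ ^ 2) ^ 2 ≤ 1 + 5 * (t * ‖f B‖ * ‖A‖) ^ 2 := by
    refine (pow_le_pow_left₀ (by positivity) h3 2).trans (h1.trans (le_of_eq ?_))
    rw [norm_mul, RCLike.norm_conj, Complex.norm_real, Real.norm_of_nonneg ht.le]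
  have h5 : 5 * (t * ‖f B‖ * ‖A‖) ^ 2 ≤ t * ‖f B‖ ^ 2 := by
    have := mul_le_mul_of_nonneg_right htC (by positivity : 0 ≤ t * ‖f B‖ ^ 2)
    nlinarith
  nlinarith [mul_pos ht hpos]

/-- Apply `norming_left` to `T*` and the functional `A ↦ conj (f (A*))`. -/
theorem norming_right {f : (H →L[ℂ] H) →ₗ[ℂ] ℂ} (hf : ∀ A, ‖f A‖ ≤ ‖A‖) {T : H →L[ℂ] H}
    (hT : ‖T‖ ≤ 1) (hfT : f T = 1) (A : H →L[ℂ] H) : f (A * (star T * T)) = f A := by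
  let f' : (H →L[ℂ] H) →ₗ[ℂ] ℂ :=
    { toFun := fun A => (starRingEnd ℂ) (f (star A))
      map_add' := fun A B => by simp
      map_smul' := fun c A => by simp }
  have h := norming_left (f := f') (fun A => by
    change ‖(starRingEnd ℂ) (f (star A))‖ ≤ _
    rw [RCLike.norm_conj, ← norm_star A]
    exact hf _) (T := star T) (by rwa [norm_star]) (by
      change (starRingEnd ℂ) (f (star (star T))) = 1
      rw [star_star, hfT, map_one]) (star A)
  have h2 : f (star (star T * star (star T) * star A)) = f (star (star A)) :=
    (starRingEnd ℂ).injective h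
  simpa only [star_mul, star_star, mul_assoc] using h2

/-- The norm has a maximum `y` on the compact closure of the image of the unit ball. Approximating
`y` by vectors `T x` shows `‖T* y‖ = 1`, and `T* y` is then a norming vector even if `y` itself is
only a limit. -/
theorem exists_norm_apply_eq_one {T : H →L[ℂ] H} (hT : IsCompactOperator T) (h1 : ‖T‖ = 1) :
    ∃ ξ, ‖ξ‖ = 1 ∧ ‖T ξ‖ = 1 := by
  have hle : ∀ z, ‖T z‖ ≤ ‖z‖ := fun z => T.le_of_opNorm_le_of_le h1.le le_rfl |>.trans (by simp)
  have hle' : ∀ z, ‖(star T) z‖ ≤ ‖z‖ := fun z =>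
    (star T).le_of_opNorm_le_of_le (by rw [norm_star, h1]) le_rfl |>.trans (by simp)
  have hK := hT.isCompact_closure_image_closedBall 1
  obtain ⟨y, hy, hmax⟩ := hK.exists_isMaxOn
    ⟨0, subset_closure ⟨0, by simp, map_zero T⟩⟩ continuous_norm.continuousOn
  have hy1 : ‖y‖ = 1 := by
    apply le_antisymm
    · have : closure (T '' Metric.closedBall 0 1) ⊆ Metric.closedBall 0 1 := by
        refine closure_minimal ?_ Metric.isClosed_closedBall
        rintro _ ⟨x, hx, rfl⟩
        rw [mem_closedBall_zero_iff] at hx ⊢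
        exact (hle x).trans hx
      simpa using this hy
    · rw [← h1]
      refine T.opNorm_le_of_unit_norm (norm_nonneg _) fun x hx => ?_
      exact hmax (subset_closure ⟨x, by simp [hx], rfl⟩)
  have hTy : 1 ≤ ‖(star T) y‖ := by
    refine le_of_forall_pos_le_add fun ε hε => ?_
    obtain ⟨_, ⟨x, hx, rfl⟩, hxε⟩ := Metric.mem_closure_iff.mp hy ε hε
    rw [mem_closedBall_zero_iff] at hx
    have e : ⟪y, y⟫_ℂ = ⟪(star T) y, x⟫_ℂ + ⟪y, y - T x⟫_ℂ := by
      rw [star_inner_left, inner_sub_right]; ring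
    calc (1 : ℝ) = ‖⟪y, y⟫_ℂ‖ := by rw [inner_self_eq_norm_sq_to_K, hy1]; simp
      _ ≤ ‖⟪(star T) y, x⟫_ℂ‖ + ‖⟪y, y - T x⟫_ℂ‖ := by rw [e]; exact norm_add_le _ _
      _ ≤ ‖(star T) y‖ * ‖x‖ + ‖y‖ * ‖y - T x‖ :=
        add_le_add (norm_inner_le_norm _ _) (norm_inner_le_norm _ _)
      _ ≤ ‖(star T) y‖ * 1 + 1 * ε := by
        rw [hy1, ← dist_eq_norm]
        gcongr
        exact hxε.le
      _ = _ := by ring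
  have h2 : ‖(star T) y‖ = 1 := le_antisymm ((hle' y).trans hy1.le) hTy
  refine ⟨(star T) y, h2, le_antisymm ((hle _).trans h2.le) ?_⟩
  calc (1 : ℝ) = ‖⟪(star T) y, (star T) y⟫_ℂ‖ := by rw [inner_self_eq_norm_sq_to_K, h2]; simp
    _ = ‖⟪y, T ((star T) y)⟫_ℂ‖ := by rw [star_inner_left]
    _ ≤ ‖y‖ * ‖T ((star T) y)‖ := norm_inner_le_norm _ _
    _ = _ := by rw [hy1, one_mul]

/-- Expand `‖T* T ξ - ξ‖²`: the cross term is `-2 ‖T ξ‖²`, so the total is at most zero. -/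
theorem star_apply_apply_of_norm_eq {T : H →L[ℂ] H} (h1 : ‖T‖ ≤ 1) {ξ : H} (h : ‖T ξ‖ = ‖ξ‖) :
    (star T) (T ξ) = ξ := by
  have hle : ‖(star T) (T ξ)‖ ≤ ‖T ξ‖ :=
    ((star T).le_of_opNorm_le (by rwa [norm_star]) _).trans (one_mul _).le
  have h2 : ‖(star T) (T ξ) - ξ‖ ^ 2 ≤ 0 := by
    rw [@norm_sub_sq ℂ, star_inner_left, inner_self_eq_norm_sq]
    have h3 : ‖(star T) (T ξ)‖ ^ 2 ≤ ‖T ξ‖ ^ 2 := by gcongr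
    rw [h] at h3 ⊢
    linarith
  have h5 : ‖(star T) (T ξ) - ξ‖ = 0 := by
    have := sq_nonneg ‖(star T) (T ξ) - ξ‖
    exact pow_eq_zero_iff two_ne_zero |>.mp (le_antisymm h2 this)
  exact sub_eq_zero.mp (norm_eq_zero.mp h5)

omit [CompleteSpace H] in
theorem finiteDimensional_eqLocus_id {K : H →L[ℂ] H} (hK : IsCompactOperator K) :
    FiniteDimensional ℂ (LinearMap.eqLocus (K : H →ₗ[ℂ] H) LinearMap.id) := by
  set V := LinearMap.eqLocus (K : H →ₗ[ℂ] H) LinearMap.id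
  have hV : ∀ v ∈ V, (K : H →ₗ[ℂ] H) v ∈ V := fun v hv => by
    have : (K : H →ₗ[ℂ] H) v = v := hv
    rwa [this]
  have hcl : IsClosed (V : Set H) := isClosed_eq K.continuous continuous_id
  have h := IsCompactOperator.restrict (f := (K : H →ₗ[ℂ] H)) hK hV hcl
  have e : ⇑((K : H →ₗ[ℂ] H).restrict hV) = id := by
    funext v
    exact Subtype.ext v.2
  rw [e] at h
  exact (isCompactOperator_id_iff_finiteDimensional (𝕜 := ℂ)).mp h

-- The conjugation is only conjugate-linear, so dimensions are compared through the images of a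
-- basis, which span the image.
omit [CompleteSpace H] in
theorem finrank_le_of_le_map_conj {F G : Submodule ℂ H} [FiniteDimensional ℂ F] (c : H →ₗ⋆[ℂ] H)
    (h : G ≤ F.map c) : FiniteDimensional ℂ G ∧ Module.finrank ℂ G ≤ Module.finrank ℂ F := by
  let b := Module.finBasis ℂ F
  have hF : F = Submodule.span ℂ (Set.range fun i => (b i : H)) := by
    have := congrArg (Submodule.map F.subtype) b.span_eq
    rw [Submodule.map_span, Submodule.map_top, Submodule.range_subtype, ← Set.range_comp] at this
    exact this.symm
  have hmap : F.map c = Submodule.span ℂ (Set.range fun i => c (b i : H)) := by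
    conv_lhs => rw [hF]
    rw [Submodule.map_span, ← Set.range_comp]
    rfl
  rw [hmap] at h
  have hfd : FiniteDimensional ℂ (Submodule.span ℂ (Set.range fun i => c (b i : H))) :=
    FiniteDimensional.span_of_finite ℂ (Set.finite_range _)
  refine ⟨Submodule.finiteDimensional_of_le h, (Submodule.finrank_mono h).trans ?_⟩
  refine (finrank_range_le_card (R := ℂ) fun i => c (b i : H)).trans ?_
  simp

end Norming

/-! ### From compact to rank one operators in the range. -/

section RankOne
variable {H : Type*} [NormedAddCommGroup H] [InnerProductSpace ℂ H] [CompleteSpace H]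
  {D : StarSubalgebra ℂ (H →L[ℂ] H)} {Φ : (H →L[ℂ] H) →ₗ[ℂ] (H →L[ℂ] H)}

open InnerProductSpace

/-- The matrix coefficient at `(η, ξ)` is not changed by `Φ`. -/
def Fixes (Φ : (H →L[ℂ] H) →ₗ[ℂ] (H →L[ℂ] H)) (η ξ : H) : Prop :=
  ∀ A, ⟪η, Φ A ξ⟫_ℂ = ⟪η, A ξ⟫_ℂ

omit [CompleteSpace H] in
theorem norm_coeff_le (hc : IsContractive Φ) {η ξ : H} (hη : ‖η‖ = 1) (hξ : ‖ξ‖ = 1)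
    (A : H →L[ℂ] H) : ‖⟪η, Φ A ξ⟫_ℂ‖ ≤ ‖A‖ := by
  refine (norm_inner_apply_le (Φ A) η ξ).trans ?_
  rw [hη, hξ, mul_one, mul_one]
  exact hc A

/-- The functional `A ↦ ⟪η, Φ A ξ⟫`. -/
noncomputable def coeff (Φ : (H →L[ℂ] H) →ₗ[ℂ] (H →L[ℂ] H)) (η ξ : H) : (H →L[ℂ] H) →ₗ[ℂ] ℂ :=
  (innerSL ℂ η).toLinearMap ∘ₗ (ContinuousLinearMap.apply ℂ H ξ).toLinearMap ∘ₗ Φ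

/-- The rank one operator `T = η ⊗ ξ*` is normed by `f A = ⟪η, Φ A ξ⟫`, so `f A = f (T T* A T* T)`,
and the argument on the right is `⟪η, A ξ⟫ • T`. -/
theorem fixes_of_inner_eq_one (hc : IsContractive Φ) {η ξ : H} (hη : ‖η‖ = 1) (hξ : ‖ξ‖ = 1)
    (h : ⟪η, Φ (rankOne ℂ η ξ) ξ⟫_ℂ = 1) : Fixes Φ η ξ := by
  intro A
  have hf : ∀ A, ‖coeff Φ η ξ A‖ ≤ ‖A‖ := norm_coeff_le hc hη hξ
  have hT : ‖rankOne ℂ η ξ‖ ≤ 1 := by rw [norm_rankOne, hη, hξ, one_mul]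
  have hs : star (rankOne ℂ η ξ) = rankOne ℂ ξ η := by
    rw [ContinuousLinearMap.star_eq_adjoint, adjoint_rankOne]
  have h1 := norming_left hf hT h A
  have h2 := norming_right hf hT h (rankOne ℂ η ξ * star (rankOne ℂ η ξ) * A)
  have h3 : rankOne ℂ η ξ * star (rankOne ℂ η ξ) * A * (star (rankOne ℂ η ξ) * rankOne ℂ η ξ)
      = ⟪η, A ξ⟫_ℂ • rankOne ℂ η ξ := by
    ext z
    simp [hs, hη, hξ, smul_smul, mul_comm]
  rw [h3, h1, map_smul] at h2
  change ⟪η, A ξ⟫_ℂ • ⟪η, Φ (rankOne ℂ η ξ) ξ⟫_ℂ = ⟪η, Φ A ξ⟫_ℂ at h2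
  rw [← h2, h, smul_eq_mul, mul_one]

theorem smul_mem_corner {ω₁ ω₂ : H} {T : H →L[ℂ] H} (hT : T ∈ corner D Φ ω₁ ω₂) (c : ℂ) :
    c • T ∈ corner D Φ ω₁ ω₂ :=
  ⟨by rw [map_smul, hT.1], by rw [mul_smul_comm, smul_mul_assoc, hT.2]⟩

theorem mul_mem_corner (hD : IsMasa D) (hΦ : IsSchurMultiplier D Φ) {ω₁ ω₂ : H} {T : H →L[ℂ] H}
    (hT : T ∈ corner D Φ ω₁ ω₂) {b : H →L[ℂ] H} (hb : b ∈ D) : T * b ∈ corner D Φ ω₁ ω₂ := by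
  constructor
  · have := hΦ.bimodule_map 1 (one_mem D) b hb T
    rwa [one_mul, one_mul, hT.1] at this
  · rw [mul_assoc, mul_assoc, hD.comm hb (hD.cyc_mem ω₂), ← mul_assoc T, ← mul_assoc, ← mul_assoc,
      hT.2]

theorem apply_mem_of_mem_corner {ω₁ ω₂ : H} {T : H →L[ℂ] H} (hT : T ∈ corner D Φ ω₁ ω₂) (v : H) :
    T v ∈ cyc D ω₁ := by
  rw [← hT.2]
  exact Submodule.starProjection_apply_mem _ _

theorem star_apply_mem_of_mem_corner {ω₁ ω₂ : H} {T : H →L[ℂ] H} (hT : T ∈ corner D Φ ω₁ ω₂)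
    (v : H) : (star T) v ∈ cyc D ω₂ := by
  rw [← hT.2, star_mul, (isSelfAdjoint_starProjection _).star_eq]
  exact Submodule.starProjection_apply_mem _ _

/-- `T` attains its norm at some `ξ`, so `A ↦ ⟪T ξ, Φ A ξ⟫` norms `T`. By `norming_left` its density
has range in the eigenspace `T T* = 1`, finite dimensional by compactness. Conjugating that density
gives `R`. -/
theorem exists_finrank_le (hD : IsMasa D) (hΦ : IsSchurIdempotent D Φ) (hc : IsContractive Φ)
    {ω₁ ω₂ : H} {T : H →L[ℂ] H} (hT : T ∈ corner D Φ ω₁ ω₂) (hcomp : IsCompactOperator T)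
    (h1 : ‖T‖ = 1) : ∃ R ∈ corner D Φ ω₁ ω₂, R ≠ 0 ∧
      FiniteDimensional ℂ (LinearMap.range (R : H →ₗ[ℂ] H)) ∧
      Module.finrank ℂ (LinearMap.range (R : H →ₗ[ℂ] H)) ≤
        Module.finrank ℂ
          (LinearMap.eqLocus ((T * star T : H →L[ℂ] H) : H →ₗ[ℂ] H) LinearMap.id) := by
  obtain ⟨ξ, hξ, hTξ⟩ := exists_norm_apply_eq_one hcomp h1
  have hξ2 : ξ ∈ cyc D ω₂ := by
    rw [← star_apply_apply_of_norm_eq h1.le (hTξ.trans hξ.symm)]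
    exact star_apply_mem_of_mem_corner hT _
  have hfT : coeff Φ (T ξ) ξ T = 1 := by
    change ⟪T ξ, Φ T ξ⟫_ℂ = 1
    rw [hT.1, inner_self_eq_norm_sq_to_K, hTξ]
    simp
  obtain ⟨R, hR, hR0, -, S, hS, hRS⟩ := exists_mem_corner hD hΦ hc
    (apply_mem_of_mem_corner hT ξ) hξ2 ⟨T, fun h => one_ne_zero (hfT.symm.trans h)⟩
  have hK : IsCompactOperator (T * star T : H →L[ℂ] H) := hcomp.comp_clm (star T)
  have hfd := finiteDimensional_eqLocus_id hK
  have hle : LinearMap.range (S : H →ₗ[ℂ] H) ≤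
      LinearMap.eqLocus ((T * star T : H →L[ℂ] H) : H →ₗ[ℂ] H) LinearMap.id := by
    rintro _ ⟨v, rfl⟩
    change (T * star T) (S v) = S v
    refine ext_inner_right ℂ fun u => ?_
    have h2 := norming_left (f := coeff Φ (T ξ) ξ) (norm_coeff_le hc hTξ hξ) h1.le hfT
      (rankOne ℂ u v)
    have h3 : T * star T * rankOne ℂ u v = rankOne ℂ ((T * star T) u) v := by
      ext z; simp
    rw [h3] at h2
    change ⟪T ξ, Φ _ ξ⟫_ℂ = ⟪T ξ, Φ _ ξ⟫_ℂ at h2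
    rw [hS, hS] at h2
    rw [← h2, ← star_inner_left, star_mul, star_star]
  have hle2 : LinearMap.range (R : H →ₗ[ℂ] H) ≤
      (LinearMap.eqLocus ((T * star T : H →L[ℂ] H) : H →ₗ[ℂ] H) LinearMap.id).map
        (conj D ω₁ : H →ₗ⋆[ℂ] H) := by
    rintro _ ⟨v, rfl⟩
    exact Submodule.map_mono hle (hRS v)
  obtain ⟨h4, h5⟩ := finrank_le_of_le_map_conj _ hle2
  exact ⟨R, hR, hR0, h4, h5⟩

/-- `T` is a nonzero finite rank operator of the corner, of least possible rank. -/
structure IsMinimalRank (D : StarSubalgebra ℂ (H →L[ℂ] H))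
    (Φ : (H →L[ℂ] H) →ₗ[ℂ] (H →L[ℂ] H)) (ω₁ ω₂ : H) (T : H →L[ℂ] H) : Prop where
  mem : T ∈ corner D Φ ω₁ ω₂
  ne_zero : T ≠ 0
  finiteDimensional : FiniteDimensional ℂ (LinearMap.range (T : H →ₗ[ℂ] H))
  le : ∀ R ∈ corner D Φ ω₁ ω₂, R ≠ 0 → FiniteDimensional ℂ (LinearMap.range (R : H →ₗ[ℂ] H)) →
    Module.finrank ℂ (LinearMap.range (T : H →ₗ[ℂ] H)) ≤
      Module.finrank ℂ (LinearMap.range (R : H →ₗ[ℂ] H))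

omit [CompleteSpace H] in
theorem range_smul_eq {T : H →L[ℂ] H} {c : ℂ} (hc : c ≠ 0) :
    LinearMap.range ((c • T : H →L[ℂ] H) : H →ₗ[ℂ] H) = LinearMap.range (T : H →ₗ[ℂ] H) := by
  rw [ContinuousLinearMap.toLinearMap_smul]
  exact LinearMap.range_smul _ _ hc

theorem IsMinimalRank.smul {ω₁ ω₂ : H} {T : H →L[ℂ] H} (h : IsMinimalRank D Φ ω₁ ω₂ T) {c : ℂ}
    (hc : c ≠ 0) : IsMinimalRank D Φ ω₁ ω₂ (c • T) where
  mem := smul_mem_corner h.mem c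
  ne_zero := smul_ne_zero hc h.ne_zero
  finiteDimensional := by rw [range_smul_eq hc]; exact h.finiteDimensional
  le := by rw [range_smul_eq hc]; exact h.le

theorem exists_isMinimalRank (hD : IsMasa D) (hΦ : IsSchurIdempotent D Φ) (hc : IsContractive Φ)
    {ω₁ ω₂ : H} (hne : ∃ A, ⟪ω₁, Φ A ω₂⟫_ℂ ≠ 0) :
    ∃ T, IsMinimalRank D Φ ω₁ ω₂ T ∧ ‖T‖ = 1 := by
  obtain ⟨T, hT, hT0, hcomp, -⟩ := exists_mem_corner hD hΦ hc (self_mem_cyc ω₁) (self_mem_cyc ω₂) hne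
  have hn : ∀ T : H →L[ℂ] H, T ≠ 0 → ‖((‖T‖ : ℂ)⁻¹) • T‖ = 1 := fun T hT => by
    rw [norm_smul, norm_inv, Complex.norm_real, norm_norm, inv_mul_cancel₀ (norm_ne_zero_iff.mpr hT)]
  obtain ⟨R, hR, hR0, hRfd, -⟩ := exists_finrank_le hD hΦ hc (smul_mem_corner hT _)
    (hcomp.smul ((‖T‖ : ℂ)⁻¹)) (hn T hT0)
  let s := {T | T ∈ corner D Φ ω₁ ω₂ ∧ T ≠ 0 ∧
    FiniteDimensional ℂ (LinearMap.range (T : H →ₗ[ℂ] H))}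
  let r : (H →L[ℂ] H) → ℕ := fun T => Module.finrank ℂ (LinearMap.range (T : H →ₗ[ℂ] H))
  have hs : s.Nonempty := ⟨R, hR, hR0, hRfd⟩
  have hm : Function.argminOn r s hs ∈ s := Function.argminOn_mem r s hs
  have hmin : IsMinimalRank D Φ ω₁ ω₂ (Function.argminOn r s hs) :=
    ⟨hm.1, hm.2.1, hm.2.2, fun R hR hR0 hRfd =>
      Function.argminOn_le r s (a := R) ⟨hR, hR0, hRfd⟩⟩
  exact ⟨_, hmin.smul (inv_ne_zero (Complex.ofReal_ne_zero.mpr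
    (norm_ne_zero_iff.mpr hmin.ne_zero))), hn _ hmin.ne_zero⟩

omit [CompleteSpace H] in
theorem isCompactOperator_of_finiteDimensional_range {T : H →L[ℂ] H}
    [FiniteDimensional ℂ (LinearMap.range (T : H →ₗ[ℂ] H))] : IsCompactOperator T := by
  have h := isCompactOperator_of_locallyCompactSpace_dom
    (T.codRestrict (LinearMap.range (T : H →ₗ[ℂ] H)) fun x => ⟨x, rfl⟩)
  exact h.clm_comp (LinearMap.range (T : H →ₗ[ℂ] H)).subtypeL

/-- The eigenspace `T T* = 1` lies in the range of `T` and, by `exists_finrank_le`, its dimension is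
at least the rank of some nonzero `R` in the corner. Minimality makes it the whole range. -/
theorem IsMinimalRank.mul_star_apply (hD : IsMasa D) (hΦ : IsSchurIdempotent D Φ)
    (hc : IsContractive Φ) {ω₁ ω₂ : H} {T : H →L[ℂ] H} (h : IsMinimalRank D Φ ω₁ ω₂ T)
    (h1 : ‖T‖ = 1) {y : H} (hy : y ∈ LinearMap.range (T : H →ₗ[ℂ] H)) : T ((star T) y) = y := by
  have := h.finiteDimensional
  obtain ⟨R, hR, hR0, hRfd, hle⟩ := exists_finrank_le hD hΦ hc h.mem
    isCompactOperator_of_finiteDimensional_range h1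
  have hsub : LinearMap.eqLocus ((T * star T : H →L[ℂ] H) : H →ₗ[ℂ] H) LinearMap.id ≤
      LinearMap.range (T : H →ₗ[ℂ] H) := fun z hz => ⟨(star T) z, hz⟩
  have heq := Submodule.eq_of_le_of_finrank_le hsub ((h.le R hR hR0 hRfd).trans hle)
  rw [← heq] at hy
  exact hy

/-- If `T b ≠ 0`, it is again of minimal rank and has the same range as `T`. After normalization,
`mul_star_apply` applies to it, and the scalar is `‖T b‖²`. -/
theorem IsMinimalRank.exists_eigenvalue (hD : IsMasa D) (hΦ : IsSchurIdempotent D Φ)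
    (hc : IsContractive Φ) {ω₁ ω₂ : H} {T : H →L[ℂ] H} (h : IsMinimalRank D Φ ω₁ ω₂ T)
    {b : H →L[ℂ] H} (hb : b ∈ D) : ∃ l : ℂ, ∀ y ∈ LinearMap.range (T : H →ₗ[ℂ] H),
      (T * (b * star b) * star T) y = l • y := by
  have := h.finiteDimensional
  by_cases h0 : T * b = 0
  · refine ⟨0, fun y _ => ?_⟩
    rw [← mul_assoc T, h0]
    simp
  have hle : LinearMap.range ((T * b : H →L[ℂ] H) : H →ₗ[ℂ] H) ≤ LinearMap.range (T : H →ₗ[ℂ] H) := by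
    rintro _ ⟨v, rfl⟩
    exact ⟨b v, rfl⟩
  have hfd := Submodule.finiteDimensional_of_le hle
  have hmem := mul_mem_corner hD hΦ.toIsSchurMultiplier h.mem hb
  have heq := Submodule.eq_of_le_of_finrank_le hle (h.le _ hmem h0 hfd)
  have hmin : IsMinimalRank D Φ ω₁ ω₂ (T * b) := ⟨hmem, h0, hfd, by rw [heq]; exact h.le⟩
  have hn : (‖T * b‖ : ℂ) ≠ 0 := Complex.ofReal_ne_zero.mpr (norm_ne_zero_iff.mpr h0)
  refine ⟨(‖T * b‖ : ℂ) ^ 2, fun y hy => ?_⟩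
  have h2 := (hmin.smul (inv_ne_zero hn)).mul_star_apply hD hΦ hc (by
    rw [norm_smul, norm_inv, Complex.norm_real, norm_norm, inv_mul_cancel₀ (norm_ne_zero_iff.mpr h0)])
    (y := y) (by rw [range_smul_eq (inv_ne_zero hn), heq]; exact hy)
  have h3 : ((‖T * b‖ : ℂ)⁻¹ • (T * b)) ((star ((‖T * b‖ : ℂ)⁻¹ • (T * b))) y)
      = ((‖T * b‖ : ℂ) ^ 2)⁻¹ • (T * (b * star b) * star T) y := by
    rw [star_smul, star_mul, smul_apply, smul_apply, map_smul, smul_smul]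
    congr 1
    simp [sq]
  rw [h3] at h2
  rw [← h2, smul_smul, mul_inv_cancel₀ (pow_ne_zero 2 hn), one_smul, h2]

theorem four_smul_eq_polarization {A : Type*} [Ring A] [StarRing A] [Algebra ℂ A] [StarModule ℂ A] (c : A) :
    (4 : ℂ) • c = (c + algebraMap ℂ _ 1) * star (c + algebraMap ℂ _ 1)
      + Complex.I • ((c + algebraMap ℂ _ Complex.I) * star (c + algebraMap ℂ _ Complex.I))
      - (c + algebraMap ℂ _ (-1)) * star (c + algebraMap ℂ _ (-1))
      - Complex.I • ((c + algebraMap ℂ _ (-Complex.I)) *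
        star (c + algebraMap ℂ _ (-Complex.I))) := by
  have hI : star Complex.I = -Complex.I := Complex.conj_I
  have h1 : star (1 : ℂ) = 1 := star_one _
  simp only [Algebra.algebraMap_eq_smul_one, star_add, star_smul, star_one, mul_add, add_mul,
      smul_mul_assoc, mul_smul_comm, one_mul, mul_one, smul_add, smul_smul, star_neg, hI, h1]
  match_scalars <;> ring_nf <;> simp only [Complex.I_sq] <;> try norm_num

/-- Polarization extends the scalar property from the elements `b b*` to all of `D`, which contains
the constants. -/
theorem IsMinimalRank.exists_eigenvalue_of_mem (hD : IsMasa D) (hΦ : IsSchurIdempotent D Φ)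
    (hc : IsContractive Φ) {ω₁ ω₂ : H} {T : H →L[ℂ] H} (h : IsMinimalRank D Φ ω₁ ω₂ T)
    {c : H →L[ℂ] H} (hcD : c ∈ D) : ∃ l : ℂ, ∀ y ∈ LinearMap.range (T : H →ₗ[ℂ] H),
      T (c ((star T) y)) = l • y := by
  have hmem : ∀ z : ℂ, c + algebraMap ℂ _ z ∈ D := fun z => add_mem hcD (algebraMap_mem D z)
  obtain ⟨l₀, h₀⟩ := h.exists_eigenvalue hD hΦ hc (hmem 1)
  obtain ⟨l₁, h₁⟩ := h.exists_eigenvalue hD hΦ hc (hmem Complex.I)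
  obtain ⟨l₂, h₂⟩ := h.exists_eigenvalue hD hΦ hc (hmem (-1))
  obtain ⟨l₃, h₃⟩ := h.exists_eigenvalue hD hΦ hc (hmem (-Complex.I))
  refine ⟨4⁻¹ * (l₀ + Complex.I * l₁ - l₂ - Complex.I * l₃), fun y hy => ?_⟩
  have hpol := four_smul_eq_polarization c
  have hlin : (4 : ℂ) • T (c ((star T) y)) =
      (l₀ + Complex.I * l₁ - l₂ - Complex.I * l₃) • y := by
    have e : (4 : ℂ) • T (c ((star T) y)) = (T * ((4 : ℂ) • c) * star T) y := by simp
    rw [e, hpol]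
    simp only [mul_add, mul_sub, add_mul, sub_mul, mul_smul_comm, smul_mul_assoc] at h₀ h₁ h₂ h₃ ⊢
    simp only [add_apply, sub_apply, smul_apply] at h₀ h₁ h₂ h₃ ⊢
    simp only [add_smul, sub_smul, mul_smul, ← h₀ y hy, ← h₁ y hy, ← h₂ y hy, ← h₃ y hy]
  rw [mul_smul, ← hlin, smul_smul, inv_mul_cancel₀ (by norm_num : (4 : ℂ) ≠ 0), one_smul]

/-- A contractive Schur idempotent that does not vanish between two cyclic subspaces fixes some
matrix coefficient between them. -/
theorem exists_fixes (hD : IsMasa D) (hΦ : IsSchurIdempotent D Φ) (hc : IsContractive Φ)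
    {ω₁ ω₂ : H} (hne : ∃ A, ⟪ω₁, Φ A ω₂⟫_ℂ ≠ 0) :
    ∃ η ∈ cyc D ω₁, ∃ ξ ∈ cyc D ω₂, η ≠ 0 ∧ ξ ≠ 0 ∧ Fixes Φ η ξ := by
  obtain ⟨T, hT, h1⟩ := exists_isMinimalRank hD hΦ hc hne
  have := hT.finiteDimensional
  obtain ⟨z, hz, hTz⟩ := exists_norm_apply_eq_one
    (isCompactOperator_of_finiteDimensional_range (T := T)) h1
  set y := T z with hy
  have hymem : y ∈ LinearMap.range (T : H →ₗ[ℂ] H) := ⟨z, rfl⟩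
  set x := (star T) y with hx
  have hTx : T x = y := hT.mul_star_apply hD hΦ hc h1 hymem
  have hxn : ‖x‖ = 1 := by
    rw [hx, hy, star_apply_apply_of_norm_eq h1.le (hTz.trans hz.symm), hz]
  -- This is where the rank becomes one. All `T c T*`, `c ∈ D`, act as scalars on the range, so `y'
  -- ⊥ y` makes `T* y'` orthogonal to `D x`. For `c` the projection onto the cyclic subspace of `x`,
  -- the scalar is 1 because of `y`, yet `T c T* y' = 0`.
  have hperp : ∀ y' ∈ LinearMap.range (T : H →ₗ[ℂ] H), ⟪y, y'⟫_ℂ = 0 → y' = 0 := by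
    intro y' hy' h0
    obtain ⟨l, hl⟩ := hT.exists_eigenvalue_of_mem hD hΦ hc (hD.cyc_mem x)
    have hl1 := hl y hymem
    rw [Submodule.starProjection_eq_self_iff.mpr (self_mem_cyc x), hTx] at hl1
    have hy0 : y ≠ 0 := fun h => by rw [h] at hTz; simp at hTz
    have hl2 : l = 1 := by
      by_contra hne
      have : (1 - l) • y = 0 := by rw [sub_smul, one_smul, ← hl1, sub_self]
      exact (smul_ne_zero (sub_ne_zero.mpr (Ne.symm hne)) hy0) this
    have h2 := hl y' hy'
    have h3 : (star T) y' ∈ (cyc D x)ᗮ := by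
      rw [Submodule.mem_orthogonal]
      intro u hu
      refine mem_of_mem_cyc (D := D) (ω := x) (s := {u | ⟪u, (star T) y'⟫_ℂ = 0})
        (isClosed_eq (by fun_prop) continuous_const) (fun a ha => ?_) hu
      obtain ⟨l', hl'⟩ := hT.exists_eigenvalue_of_mem hD hΦ hc ha
      rw [Set.mem_ofPred_eq, star_inner_right, hx, hl' y hymem, inner_smul_left, h0, mul_zero]
    rw [(Submodule.starProjection_apply_eq_zero_iff _).mpr h3, map_zero, hl2, one_smul] at h2
    exact h2.symm
  have hTeq : T = rankOne ℂ y x := by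
    ext v
    have h2 := hperp (T v - ⟪y, T v⟫_ℂ • y)
      (sub_mem ⟨v, rfl⟩ (Submodule.smul_mem _ _ hymem)) (by
        rw [inner_sub_right, inner_smul_right, inner_self_eq_norm_sq_to_K, hTz]; simp)
    rw [rankOne_apply, hx, star_inner_left]
    exact sub_eq_zero.mp h2
  refine ⟨y, apply_mem_of_mem_corner hT.mem z, x, star_apply_mem_of_mem_corner hT.mem y, ?_, ?_, ?_⟩
  · intro h; rw [h] at hTz; simp at hTz
  · intro h; rw [h] at hxn; simp at hxn
  · refine fixes_of_inner_eq_one hc hTz hxn ?_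
    rw [← hTeq, hT.mem.1, hTx, inner_self_eq_norm_sq_to_K, hTz]
    simp

end RankOne

/-! ### Fixed pairs of vectors and the block decomposition. -/

section Blocks
variable {H : Type*} [NormedAddCommGroup H] [InnerProductSpace ℂ H]
  {Φ : (H →L[ℂ] H) →ₗ[ℂ] (H →L[ℂ] H)}

open InnerProductSpace

theorem Fixes.add_left {η η' ξ : H} (h : Fixes Φ η ξ) (h' : Fixes Φ η' ξ) :
    Fixes Φ (η + η') ξ := fun A => by rw [inner_add_left, inner_add_left, h A, h' A]

theorem Fixes.add_right {η ξ ξ' : H} (h : Fixes Φ η ξ) (h' : Fixes Φ η ξ') :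
    Fixes Φ η (ξ + ξ') := fun A => by
  rw [map_add, map_add, inner_add_right, inner_add_right, h A, h' A]

theorem Fixes.smul_left {η ξ : H} (h : Fixes Φ η ξ) (c : ℂ) : Fixes Φ (c • η) ξ := fun A => by
  rw [inner_smul_left, inner_smul_left, h A]

theorem Fixes.smul_right {η ξ : H} (h : Fixes Φ η ξ) (c : ℂ) : Fixes Φ η (c • ξ) := fun A => by
  rw [map_smul, map_smul, inner_smul_right, inner_smul_right, h A]

theorem Fixes.zero_left (ξ : H) : Fixes Φ 0 ξ := fun A => by simp

theorem Fixes.zero_right (η : H) : Fixes Φ η 0 := fun A => by simp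

/-- The vectors `ξ` such that the matrix coefficients at `(η, ξ)` are fixed. -/
def rightSpace (Φ : (H →L[ℂ] H) →ₗ[ℂ] (H →L[ℂ] H)) (η : H) : Submodule ℂ H where
  carrier := {ξ | Fixes Φ η ξ}
  add_mem' := Fixes.add_right
  zero_mem' := Fixes.zero_right η
  smul_mem' c _ h := Fixes.smul_right h c

/-- The vectors `η` such that the matrix coefficients at `(η, ξ)` are fixed for all `ξ ∈ N`. -/
def leftSpace (Φ : (H →L[ℂ] H) →ₗ[ℂ] (H →L[ℂ] H)) (N : Submodule ℂ H) : Submodule ℂ H where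
  carrier := {η | ∀ ξ ∈ N, Fixes Φ η ξ}
  add_mem' h h' ξ hξ := (h ξ hξ).add_left (h' ξ hξ)
  zero_mem' ξ _ := Fixes.zero_left ξ
  smul_mem' c _ h ξ hξ := (h ξ hξ).smul_left c

theorem isClosed_rightSpace (η : H) : IsClosed (rightSpace Φ η : Set H) := by
  have : (rightSpace Φ η : Set H) = ⋂ A, {ξ | ⟪η, Φ A ξ⟫_ℂ = ⟪η, A ξ⟫_ℂ} := by
    ext; simp [rightSpace, Fixes]
  rw [this]
  exact isClosed_iInter fun A => isClosed_eq (by fun_prop) (by fun_prop)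

theorem isClosed_leftSpace (N : Submodule ℂ H) : IsClosed (leftSpace Φ N : Set H) := by
  have : (leftSpace Φ N : Set H) = ⋂ ξ ∈ N, ⋂ A, {η | ⟪η, Φ A ξ⟫_ℂ = ⟪η, A ξ⟫_ℂ} := by
    ext; simp [leftSpace, Fixes]
  rw [this]
  exact isClosed_biInter fun ξ _ => isClosed_iInter fun A =>
    isClosed_eq (by fun_prop) (by fun_prop)

variable [CompleteSpace H] {D : StarSubalgebra ℂ (H →L[ℂ] H)}

theorem Fixes.apply (hΦ : IsSchurMultiplier D Φ) {η ξ : H} (h : Fixes Φ η ξ) {a b : H →L[ℂ] H}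
    (ha : a ∈ D) (hb : b ∈ D) : Fixes Φ (a η) (b ξ) := fun A => by
  have h1 := h (star a * A * b)
  rw [hΦ.bimodule_map _ (star_mem ha) _ hb] at h1
  simpa only [mul_apply_eq_comp, star_inner_right] using h1

theorem rightSpace_invariant (hΦ : IsSchurMultiplier D Φ) (η : H) :
    ∀ a ∈ D, ∀ x ∈ rightSpace Φ η, a x ∈ rightSpace Φ η := fun _ ha _ hx =>
  Fixes.apply hΦ hx (one_mem D) ha

theorem leftSpace_invariant (hΦ : IsSchurMultiplier D Φ) (N : Submodule ℂ H) :
    ∀ a ∈ D, ∀ x ∈ leftSpace Φ N, a x ∈ leftSpace Φ N := fun _ ha _ hx ξ hξ =>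
  Fixes.apply hΦ (hx ξ hξ) ha (one_mem D)

theorem orthogonal_invariant {K : Submodule ℂ H} (hK : ∀ a ∈ D, ∀ x ∈ K, a x ∈ K) :
    ∀ a ∈ D, ∀ x ∈ Kᗮ, a x ∈ Kᗮ := by
  intro a ha x hx
  rw [Submodule.mem_orthogonal]
  intro u hu
  rw [← star_inner_left]
  exact Submodule.inner_right_of_mem_orthogonal (hK _ (star_mem ha) u hu) hx

theorem iSup_invariant {J : Type*} {K : J → Submodule ℂ H}
    (hK : ∀ j, ∀ a ∈ D, ∀ x ∈ K j, a x ∈ K j) : ∀ a ∈ D, ∀ x ∈ ⨆ j, K j, a x ∈ ⨆ j, K j := by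
  intro a ha x hx
  have h : (⨆ j, K j) ≤ (⨆ j, K j).comap (a : H →ₗ[ℂ] H) :=
    iSup_le fun j y hy => Submodule.mem_iSup_of_mem j (hK j a ha y hy)
  exact h hx

/-- Fixedness passes to all pairs in the two cyclic subspaces. The bimodule property confines `Φ (η
⊗ ξ*)` to that corner, so those coefficients determine it. -/
theorem Fixes.map_rankOne (hD : IsMasa D) (hΦ : IsSchurMultiplier D Φ) {η ξ : H}
    (h : Fixes Φ η ξ) : Φ (rankOne ℂ η ξ) = rankOne ℂ η ξ := by
  have hmem : ∀ u ∈ cyc D η, ∀ v ∈ cyc D ξ, Fixes Φ u v := by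
    intro u hu v hv
    have hv' : Fixes Φ η v := cyc_le (isClosed_rightSpace η) (rightSpace_invariant hΦ η) h hv
    have hu' : u ∈ leftSpace Φ (ℂ ∙ v) := by
      refine cyc_le (isClosed_leftSpace _) (leftSpace_invariant hΦ _) ?_ hu
      intro w hw
      obtain ⟨c, rfl⟩ := Submodule.mem_span_singleton.mp hw
      exact hv'.smul_right c
    exact hu' v (Submodule.mem_span_singleton_self v)
  have hpq : (cyc D η).starProjection * rankOne ℂ η ξ * (cyc D ξ).starProjection
      = rankOne ℂ η ξ := by
    ext z
    change (cyc D η).starProjection (⟪ξ, (cyc D ξ).starProjection z⟫_ℂ • η) = ⟪ξ, z⟫_ℂ • η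
    rw [map_smul, Submodule.starProjection_eq_self_iff.mpr (self_mem_cyc η),
      ← Submodule.inner_starProjection_left_eq_right,
      Submodule.starProjection_eq_self_iff.mpr (self_mem_cyc ξ)]
  rw [← hpq, hΦ.bimodule_map _ (hD.cyc_mem η) _ (hD.cyc_mem ξ)]
  ext z
  refine ext_inner_left ℂ fun w => ?_
  simp only [mul_apply_eq_comp]
  rw [← Submodule.inner_starProjection_left_eq_right, ← Submodule.inner_starProjection_left_eq_right]
  exact hmem _ (Submodule.starProjection_apply_mem _ _) _ (Submodule.starProjection_apply_mem _ _) _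

-- On orthonormal pairs this is the Hadamard matrix with rows `(1, 1)` and `(1, -1)`, `√2` times a
-- unitary; Bessel bounds the other directions.
omit [CompleteSpace H] in
theorem norm_hadamard_le {η η' ξ ξ' : H} (hη : ‖η‖ = 1) (hη' : ‖η'‖ = 1) (hηη' : ⟪η, η'⟫_ℂ = 0)
    (hξ : ‖ξ‖ = 1) (hξ' : ‖ξ'‖ = 1) (hξξ' : ⟪ξ, ξ'⟫_ℂ = 0) :
    ‖rankOne ℂ η ξ + rankOne ℂ η ξ' + rankOne ℂ η' ξ - rankOne ℂ η' ξ'‖ ≤ √2 := by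
  refine ContinuousLinearMap.opNorm_le_bound _ (Real.sqrt_nonneg _) fun z => ?_
  refine le_of_sq_le_sq ?_ (by positivity)
  rw [mul_pow, Real.sq_sqrt (by norm_num)]
  set a := ⟪ξ, z⟫_ℂ with ha
  set b := ⟪ξ', z⟫_ℂ with hb
  have e : (rankOne ℂ η ξ + rankOne ℂ η ξ' + rankOne ℂ η' ξ - rankOne ℂ η' ξ') z
      = (a + b) • η + (a - b) • η' := by
    simp only [add_apply, sub_apply, rankOne_apply, add_smul, sub_smul, ha, hb]
    abel
  have hon : Orthonormal ℂ ![ξ, ξ'] := by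
    refine ⟨fun i => by fin_cases i <;> simpa, fun i j hij => ?_⟩
    fin_cases i <;> fin_cases j <;> simp_all [inner_eq_zero_symm]
  have hbessel := hon.sum_inner_products_le z (s := Finset.univ)
  rw [Fin.sum_univ_two] at hbessel
  change ‖a‖ ^ 2 + ‖b‖ ^ 2 ≤ ‖z‖ ^ 2 at hbessel
  have hpar := parallelogram_law_with_norm ℝ a b
  have horth : ‖(a + b) • η + (a - b) • η'‖ * ‖(a + b) • η + (a - b) • η'‖ =
      ‖(a + b) • η‖ * ‖(a + b) • η‖ + ‖(a - b) • η'‖ * ‖(a - b) • η'‖ :=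
    norm_add_sq_eq_norm_sq_add_norm_sq_of_inner_eq_zero (𝕜 := ℂ) _ _
      (by rw [inner_smul_left, inner_smul_right, hηη', mul_zero, mul_zero])
  rw [norm_smul, norm_smul, hη, hη', mul_one, mul_one] at horth
  rw [e, sq, horth]
  nlinarith

/-- Let `B` be the image of the Hadamard operator. The known corners and `‖B‖ ≤ √2` force `B ξ = η +
η'`, so `B` attains `√2` at `ξ` and must preserve `ξ ⊥ ξ'`. The fourth entry of `B` is therefore
`-1`, that is, `⟪η', Φ (η' ⊗ ξ'*) ξ'⟫ = 1`. -/
theorem three_corner_orthonormal (hD : IsMasa D) (hΦ : IsSchurMultiplier D Φ)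
    (hc : IsContractive Φ) {η η' ξ ξ' : H} (hη : ‖η‖ = 1) (hη' : ‖η'‖ = 1) (hηη' : ⟪η, η'⟫_ℂ = 0)
    (hξ : ‖ξ‖ = 1) (hξ' : ‖ξ'‖ = 1) (hξξ' : ⟪ξ, ξ'⟫_ℂ = 0) (h₁ : Fixes Φ η ξ) (h₂ : Fixes Φ η ξ')
    (h₃ : Fixes Φ η' ξ) : Fixes Φ η' ξ' := by
  refine fixes_of_inner_eq_one hc hη' hξ' ?_
  set A := rankOne ℂ η ξ + rankOne ℂ η ξ' + rankOne ℂ η' ξ - rankOne ℂ η' ξ' with hA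
  set B := Φ A with hB
  have hself : ∀ {v : H}, ‖v‖ = 1 → ⟪v, v⟫_ℂ = 1 := fun {v} hv => by
    rw [inner_self_eq_norm_sq_to_K, hv]; simp
  have hη'η : ⟪η', η⟫_ℂ = 0 := inner_eq_zero_symm.mp hηη'
  have hξ'ξ : ⟪ξ', ξ⟫_ℂ = 0 := inner_eq_zero_symm.mp hξξ'
  have hBn : ‖B‖ ≤ √2 := (hc A).trans (norm_hadamard_le hη hη' hηη' hξ hξ' hξξ')
  have hAξ : A ξ = η + η' := by
    simp [hA, hξ, hξ'ξ]
  have hAξ' : A ξ' = η - η' := by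
    simp [hA, hξ', hξξ']
  have hBξ₁ : ⟪η, B ξ⟫_ℂ = 1 := by rw [h₁ A, hAξ, inner_add_right, hself hη, hηη', add_zero]
  have hBξ₃ : ⟪η', B ξ⟫_ℂ = 1 := by rw [h₃ A, hAξ, inner_add_right, hself hη', hη'η, zero_add]
  have hBξ₂ : ⟪η, B ξ'⟫_ℂ = 1 := by rw [h₂ A, hAξ', inner_sub_right, hself hη, hηη', sub_zero]
  have hs2 : √2 * √2 = (2 : ℝ) := Real.mul_self_sqrt (by norm_num)
  have hsum : ‖η + η'‖ * ‖η + η'‖ = 2 := by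
    rw [norm_add_sq_eq_norm_sq_add_norm_sq_of_inner_eq_zero (𝕜 := ℂ) _ _ hηη', hη, hη']; norm_num
  have hBξ : B ξ = η + η' := by
    have h4 : ‖B ξ‖ ≤ √2 := by simpa [hξ] using B.le_of_opNorm_le hBn ξ
    have h5 : ‖B ξ - (η + η')‖ ^ 2 ≤ 0 := by
      rw [@norm_sub_sq ℂ, ← inner_re_symm, inner_add_left, hBξ₁, hBξ₃, sq ‖η + η'‖, hsum]
      have h6 : ‖B ξ‖ ^ 2 ≤ 2 := by
        rw [sq, ← hs2]; exact mul_self_le_mul_self (norm_nonneg _) h4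
      norm_num
      linarith
    have h7 : ‖B ξ - (η + η')‖ = 0 :=
      pow_eq_zero_iff two_ne_zero |>.mp (le_antisymm h5 (sq_nonneg _))
    exact sub_eq_zero.mp (norm_eq_zero.mp h7)
  have hsq : (√2 : ℝ) ≠ 0 := by positivity
  have horth : ⟪B ξ, B ξ'⟫_ℂ = 0 := by
    set C : H →L[ℂ] H := ((√2 : ℝ) : ℂ)⁻¹ • B with hC
    have hC1 : ‖C‖ ≤ 1 := by
      rw [hC, norm_smul, norm_inv, Complex.norm_real, Real.norm_of_nonneg (Real.sqrt_nonneg _),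
        inv_mul_le_iff₀ (by positivity), mul_one]
      exact hBn
    have hCξ : ‖C ξ‖ = ‖ξ‖ := by
      rw [hC, smul_apply, norm_smul, norm_inv, Complex.norm_real,
        Real.norm_of_nonneg (Real.sqrt_nonneg _), hBξ, hξ, inv_mul_eq_one₀ hsq]
      nlinarith [norm_nonneg (η + η'), Real.sqrt_nonneg 2]
    have h8 : ⟪C ξ, C ξ'⟫_ℂ = 0 := by
      rw [← star_inner_left, star_apply_apply_of_norm_eq hC1 hCξ, hξξ']
    rw [hC, smul_apply, smul_apply, inner_smul_left, inner_smul_right] at h8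
    have hsc : ((√2 : ℝ) : ℂ)⁻¹ ≠ 0 := inv_ne_zero (Complex.ofReal_ne_zero.mpr hsq)
    simpa [hsc] using h8
  rw [hBξ, inner_add_left, hBξ₂] at horth
  have hexp : ⟪η', B ξ'⟫_ℂ = -⟪η', Φ (rankOne ℂ η' ξ') ξ'⟫_ℂ := by
    rw [hB, hA, map_sub, map_add, map_add, h₁.map_rankOne hD hΦ, h₂.map_rankOne hD hΦ,
      h₃.map_rankOne hD hΦ]
    simp [hξξ', hη'η]
  rw [hexp] at horth
  linear_combination -horth

omit [CompleteSpace H] in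
theorem Fixes.of_smul {η ξ : H} {c d : ℂ} (hc : c ≠ 0) (hd : d ≠ 0)
    (h : Fixes Φ (c • η) (d • ξ)) : Fixes Φ η ξ := by
  have := (h.smul_left c⁻¹).smul_right d⁻¹
  rwa [smul_smul, smul_smul, inv_mul_cancel₀ hc, inv_mul_cancel₀ hd, one_smul, one_smul] at this

/-- The symbol of a contractive Schur idempotent contains no isolated three corners of a
rectangle. -/
theorem three_corner (hD : IsMasa D) (hΦ : IsSchurMultiplier D Φ) (hc : IsContractive Φ)
    {η η' ξ ξ' : H} (hη : η ≠ 0) (hξ : ξ ≠ 0) (h₁ : Fixes Φ η ξ) (h₂ : Fixes Φ η ξ')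
    (h₃ : Fixes Φ η' ξ) : Fixes Φ η' ξ' := by
  -- Subtracting the components along `η` and `ξ` keeps the corners fixed, so the orthogonal case
  -- suffices.
  have hdec : ∀ {u : H} (v : H), u ≠ 0 → ∃ (c : ℂ) (w : H), v = c • u + w ∧ ⟪u, w⟫_ℂ = 0 := by
    intro u v hu
    refine ⟨⟪u, v⟫_ℂ / ⟪u, u⟫_ℂ, v - (⟪u, v⟫_ℂ / ⟪u, u⟫_ℂ) • u, by abel, ?_⟩
    rw [inner_sub_right, inner_smul_right, div_mul_cancel₀ _ (inner_self_ne_zero.mpr hu), sub_self]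
  obtain ⟨c, η₀, rfl, hηη₀⟩ := hdec η' hη
  obtain ⟨d, ξ₀, rfl, hξξ₀⟩ := hdec ξ' hξ
  have h₃' : Fixes Φ η₀ ξ := by
    have := h₃.add_left (h₁.smul_left (-c))
    rwa [neg_smul, add_neg_eq_iff_eq_add.mpr (add_comm _ _)] at this
  have h₂' : Fixes Φ η ξ₀ := by
    have := h₂.add_right (h₁.smul_right (-d))
    rwa [neg_smul, add_neg_eq_iff_eq_add.mpr (add_comm _ _)] at this
  suffices h : Fixes Φ η₀ ξ₀ from (h₂.smul_left c).add_left ((h₃'.smul_right d).add_right h)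
  by_cases hη₀ : η₀ = 0
  · rw [hη₀]; exact Fixes.zero_left _
  by_cases hξ₀ : ξ₀ = 0
  · rw [hξ₀]; exact Fixes.zero_right _
  have hn : ∀ {v : H}, v ≠ 0 → ((‖v‖ : ℂ)⁻¹) ≠ 0 ∧ ‖((‖v‖ : ℂ)⁻¹) • v‖ = 1 := fun {v} hv => by
    have := norm_ne_zero_iff.mpr hv
    refine ⟨inv_ne_zero (Complex.ofReal_ne_zero.mpr this), ?_⟩
    rw [norm_smul, norm_inv, Complex.norm_real, norm_norm, inv_mul_cancel₀ this]
  refine Fixes.of_smul (hn hη₀).1 (hn hξ₀).1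
    (three_corner_orthonormal hD hΦ hc (hn hη).2 (hn hη₀).2 ?_ (hn hξ).2 (hn hξ₀).2 ?_
      ((h₁.smul_left _).smul_right _) ((h₂'.smul_left _).smul_right _)
      ((h₃'.smul_left _).smul_right _))
  · rw [inner_smul_left, inner_smul_right, hηη₀, mul_zero, mul_zero]
  · rw [inner_smul_left, inner_smul_right, hξξ₀, mul_zero, mul_zero]

/-- The projection onto `K` belongs to `D`, so it maps `L` into `K ∩ L`. -/
theorem IsMasa.isOrtho_of_disjoint (hD : IsMasa D) {K L : Submodule ℂ H}
    (hKc : IsClosed (K : Set H)) (hLc : IsClosed (L : Set H)) (hK : ∀ a ∈ D, ∀ x ∈ K, a x ∈ K)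
    (hL : ∀ a ∈ D, ∀ x ∈ L, a x ∈ L) (h : ∀ x ∈ K, x ∈ L → x = 0) : K ⟂ L := by
  have : CompleteSpace K := hKc.completeSpace_coe
  have : CompleteSpace L := hLc.completeSpace_coe
  rw [Submodule.isOrtho_iff_inner_eq]
  intro x hx y hy
  have hpL := hL _ (hD.starProjection_mem K hK) y hy
  rw [← Submodule.starProjection_eq_self_iff.mpr hx, Submodule.inner_starProjection_left_eq_right,
    h _ (Submodule.starProjection_apply_mem K y) hpL, inner_zero_right]

/-- The index set of the blocks: the nonzero subspaces `rightSpace Φ η`. -/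
abbrev BlockIndex (Φ : (H →L[ℂ] H) →ₗ[ℂ] (H →L[ℂ] H)) : Type _ :=
  {N : Submodule ℂ H // N ≠ ⊥ ∧ ∃ η ≠ 0, N = rightSpace Φ η}

/-- If `(η, ξ)`, `(η', ξ)` and `(η, z)` are fixed, so is the fourth corner `(η', z)`. Thus right
spaces that meet nontrivially coincide. -/
theorem rightSpace_eq_of_fixes (hD : IsMasa D) (hΦ : IsSchurMultiplier D Φ) (hc : IsContractive Φ)
    {η η' ξ : H} (hη : η ≠ 0) (hη' : η' ≠ 0) (hξ : ξ ≠ 0) (h : Fixes Φ η ξ) (h' : Fixes Φ η' ξ) :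
    rightSpace Φ η = rightSpace Φ η' :=
  le_antisymm (fun _ hz => three_corner hD hΦ hc hη hξ h hz h')
    (fun _ hz => three_corner hD hΦ hc hη' hξ h' hz h)

theorem BlockIndex.eq_rightSpace (hD : IsMasa D) (hΦ : IsSchurMultiplier D Φ)
    (hc : IsContractive Φ) (N : BlockIndex Φ) {η ξ : H} (hη : η ≠ 0) (hξ : ξ ≠ 0)
    (hξN : ξ ∈ N.1) (h : Fixes Φ η ξ) : N.1 = rightSpace Φ η := by
  obtain ⟨-, η₀, hη₀, hN⟩ := N.2
  rw [hN]
  refine rightSpace_eq_of_fixes hD hΦ hc hη₀ hη hξ ?_ h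
  rw [hN] at hξN
  exact hξN

/-- The block decomposition of a contractive Schur idempotent. -/
structure IsBlockDecomposition (Φ : (H →L[ℂ] H) →ₗ[ℂ] (H →L[ℂ] H)) {J : Type*}
    (M N : J → Submodule ℂ H) : Prop where
  isClosed_left : ∀ j, IsClosed (M j : Set H)
  isClosed_right : ∀ j, IsClosed (N j : Set H)
  ortho_left : ∀ i j, i ≠ j → M i ⟂ M j
  ortho_right : ∀ i j, i ≠ j → N i ⟂ N j
  dense_left : (⨆ j, M j)ᗮ = ⊥
  dense_right : (⨆ j, N j)ᗮ = ⊥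
  fixes : ∀ j, ∀ η ∈ M j, ∀ ξ ∈ N j, Fixes Φ η ξ
  off_diagonal : ∀ i j, i ≠ j → ∀ η ∈ M i, ∀ ξ ∈ N j, ∀ A, ⟪η, Φ A ξ⟫_ℂ = 0

/-- The left block spaces. -/
noncomputable def leftBlock (Φ : (H →L[ℂ] H) →ₗ[ℂ] (H →L[ℂ] H)) :
    BlockIndex Φ ⊕ Bool → Submodule ℂ H
  | .inl N => leftSpace Φ N.1
  | .inr false => (⨆ N : BlockIndex Φ, leftSpace Φ N.1)ᗮ
  | .inr true => ⊥

/-- The right block spaces. -/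
noncomputable def rightBlock (Φ : (H →L[ℂ] H) →ₗ[ℂ] (H →L[ℂ] H)) :
    BlockIndex Φ ⊕ Bool → Submodule ℂ H
  | .inl N => N.1
  | .inr false => ⊥
  | .inr true => (⨆ N : BlockIndex Φ, N.1)ᗮ

omit [CompleteSpace H] in
theorem BlockIndex.isClosed (N : BlockIndex Φ) : IsClosed (N.1 : Set H) := by
  obtain ⟨-, η, -, hN⟩ := N.2
  rw [hN]
  exact isClosed_rightSpace η

theorem BlockIndex.invariant (hΦ : IsSchurMultiplier D Φ) (N : BlockIndex Φ) :
    ∀ a ∈ D, ∀ x ∈ N.1, a x ∈ N.1 := by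
  obtain ⟨-, η, -, hN⟩ := N.2
  rw [hN]
  exact rightSpace_invariant hΦ η

theorem isBlockDecomposition (hD : IsMasa D) (hΦ : IsSchurIdempotent D Φ) (hc : IsContractive Φ) :
    IsBlockDecomposition Φ (leftBlock Φ) (rightBlock Φ) := by
  have hM := hΦ.toIsSchurMultiplier
  have hcl : ∀ j, IsClosed (leftBlock Φ j : Set H) := by
    rintro (N | _ | _)
    · exact isClosed_leftSpace _
    · exact Submodule.isClosed_orthogonal _
    · exact isClosed_singleton
  have hcr : ∀ j, IsClosed (rightBlock Φ j : Set H) := by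
    rintro (N | _ | _)
    · exact N.isClosed
    · exact isClosed_singleton
    · exact Submodule.isClosed_orthogonal _
  have hbot : ∀ a ∈ D, ∀ x ∈ (⊥ : Submodule ℂ H), a x ∈ (⊥ : Submodule ℂ H) := fun a _ x hx => by
    rw [Submodule.mem_bot] at hx ⊢; rw [hx, map_zero]
  have hil : ∀ j, ∀ a ∈ D, ∀ x ∈ leftBlock Φ j, a x ∈ leftBlock Φ j := by
    rintro (N | _ | _)
    · exact leftSpace_invariant hM _
    · exact orthogonal_invariant (iSup_invariant fun N => leftSpace_invariant hM _)
    · exact hbot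
  have hir : ∀ j, ∀ a ∈ D, ∀ x ∈ rightBlock Φ j, a x ∈ rightBlock Φ j := by
    rintro (N | _ | _)
    · exact N.invariant hM
    · exact hbot
    · exact orthogonal_invariant (iSup_invariant fun N => N.invariant hM)
  have hol : ∀ i j, i ≠ j → leftBlock Φ i ⟂ leftBlock Φ j := by
    have h1 : ∀ N : BlockIndex Φ, leftBlock Φ (.inl N) ⟂ leftBlock Φ (.inr false) := fun N =>
      (Submodule.isOrtho_orthogonal_right _).mono_left
        (le_iSup (fun N : BlockIndex Φ => leftSpace Φ N.1) N)
    rintro (N | _ | _) (N' | _ | _) hne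
    · refine hD.isOrtho_of_disjoint (hcl _) (hcl _) (hil _) (hil _) fun x hx hx' => ?_
      by_contra hx0
      refine hne (congrArg _ (Subtype.ext ?_))
      obtain ⟨ξ, hξ, hξ0⟩ := Submodule.exists_mem_ne_zero_of_ne_bot N.2.1
      obtain ⟨ξ', hξ', hξ0'⟩ := Submodule.exists_mem_ne_zero_of_ne_bot N'.2.1
      rw [N.eq_rightSpace hD hM hc hx0 hξ0 hξ (hx ξ hξ),
        N'.eq_rightSpace hD hM hc hx0 hξ0' hξ' (hx' ξ' hξ')]
    · exact h1 N
    · exact Submodule.isOrtho_bot_right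
    · exact (h1 N').symm
    · exact absurd rfl hne
    · exact Submodule.isOrtho_bot_right
    · exact Submodule.isOrtho_bot_left
    · exact Submodule.isOrtho_bot_left
    · exact absurd rfl hne
  have hor : ∀ i j, i ≠ j → rightBlock Φ i ⟂ rightBlock Φ j := by
    have h1 : ∀ N : BlockIndex Φ, rightBlock Φ (.inl N) ⟂ rightBlock Φ (.inr true) := fun N =>
      (Submodule.isOrtho_orthogonal_right _).mono_left
        (le_iSup (fun N : BlockIndex Φ => N.1) N)
    rintro (N | _ | _) (N' | _ | _) hne
    · refine hD.isOrtho_of_disjoint (hcr _) (hcr _) (hir _) (hir _) fun x hx hx' => ?_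
      by_contra hx0
      refine hne (congrArg _ (Subtype.ext ?_))
      obtain ⟨-, η, hη0, hη⟩ := N.2
      have hx2 : x ∈ rightSpace Φ η := hη ▸ hx
      rw [N'.eq_rightSpace hD hM hc hη0 hx0 hx' hx2, hη]
    · exact Submodule.isOrtho_bot_right
    · exact h1 N
    · exact Submodule.isOrtho_bot_left
    · exact absurd rfl hne
    · exact Submodule.isOrtho_bot_left
    · exact (h1 N').symm
    · exact Submodule.isOrtho_bot_right
    · exact absurd rfl hne
  refine ⟨hcl, hcr, hol, hor, ?_, ?_, ?_, ?_⟩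
  · rw [Submodule.eq_bot_iff]
    intro x hx
    have h1 : x ∈ leftBlock Φ (.inr false) :=
      Submodule.orthogonal_le (iSup_le fun N => le_iSup (leftBlock Φ) (.inl N)) hx
    exact inner_self_eq_zero.mp (Submodule.inner_right_of_mem_orthogonal
      (Submodule.mem_iSup_of_mem (.inr false) h1) hx)
  · rw [Submodule.eq_bot_iff]
    intro x hx
    have h1 : x ∈ rightBlock Φ (.inr true) :=
      Submodule.orthogonal_le (iSup_le fun N => le_iSup (rightBlock Φ) (.inl N)) hx
    exact inner_self_eq_zero.mp (Submodule.inner_right_of_mem_orthogonal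
      (Submodule.mem_iSup_of_mem (.inr true) h1) hx)
  · rintro (N | _ | _) η hη ξ hξ
    · exact hη ξ hξ
    · rw [(Submodule.mem_bot ℂ).mp hξ]; exact Fixes.zero_right η
    · rw [(Submodule.mem_bot ℂ).mp hη]; exact Fixes.zero_left ξ
  · intro i j hij η hη ξ hξ A
    by_contra hne
    -- A nonzero coefficient yields a fixed pair inside `M i × N j`. Its own block meets both `M i`
    -- and `N j` nontrivially, so orthogonality forces `i = j`.
    obtain ⟨η₁, hη₁, ξ₁, hξ₁, hη0, hξ0, hfix⟩ := exists_fixes hD hΦ hc ⟨A, hne⟩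
    have hη₁' := cyc_le (hcl i) (hil i) hη hη₁
    have hξ₁' := cyc_le (hcr j) (hir j) hξ hξ₁
    have hNbot : rightSpace Φ η₁ ≠ ⊥ := fun h =>
      hξ0 ((Submodule.mem_bot ℂ).mp (h ▸ (show ξ₁ ∈ rightSpace Φ η₁ from hfix)))
    let N : BlockIndex Φ := ⟨rightSpace Φ η₁, hNbot, η₁, hη0, rfl⟩
    have hηN : η₁ ∈ leftBlock Φ (.inl N) := fun ξ hξ => hξ
    have hξN : ξ₁ ∈ rightBlock Φ (.inl N) := hfix
    have hi : i = .inl N := by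
      by_contra h
      exact hη0 (inner_self_eq_zero.mp (Submodule.isOrtho_iff_inner_eq.mp (hol _ _ h) _ hη₁' _ hηN))
    have hj : j = .inl N := by
      by_contra h
      exact hξ0 (inner_self_eq_zero.mp (Submodule.isOrtho_iff_inner_eq.mp (hor _ _ h) _ hξ₁' _ hξN))
    exact hij (hi.trans hj.symm)

end Blocks

/-! ### The Arveson estimate by averaging over signs. -/

section ArvesonBound
variable {H : Type*} [NormedAddCommGroup H] [InnerProductSpace ℂ H]
  {Φ : (H →L[ℂ] H) →ₗ[ℂ] (H →L[ℂ] H)}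

open InnerProductSpace

omit [InnerProductSpace ℂ H] in
theorem bddBelow_range_norm {J : Type*} (f : J → H) : BddBelow (Set.range fun j => ‖f j‖) :=
  ⟨0, by rintro _ ⟨j, rfl⟩; exact norm_nonneg _⟩

theorem arvesonDist_nonneg (T : H →L[ℂ] H) (𝒳 : Submodule ℂ (H →L[ℂ] H)) :
    0 ≤ arvesonDist T 𝒳 :=
  Real.iSup_nonneg fun _ => Real.iInf_nonneg fun _ => norm_nonneg _

theorem iInf_norm_le_arvesonDist (T : H →L[ℂ] H) (𝒳 : Submodule ℂ (H →L[ℂ] H)) {ξ : H}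
    (hξ : ‖ξ‖ = 1) : ⨅ X : 𝒳, ‖T ξ - (X : H →L[ℂ] H) ξ‖ ≤ arvesonDist T 𝒳 := by
  refine le_ciSup (f := fun ξ : {ξ : H // ‖ξ‖ = 1} => ⨅ X : 𝒳, ‖T ξ - (X : H →L[ℂ] H) ξ‖)
    ⟨‖T‖, ?_⟩ ⟨ξ, hξ⟩
  rintro _ ⟨ζ, rfl⟩
  refine (ciInf_le (bddBelow_range_norm _) 0).trans ?_
  simpa [ζ.2] using T.le_opNorm ζ

/-- Subtracting `X ξ` from `T ξ` does not change the coefficient, so it is bounded by `‖η‖` times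
the distance from `T ξ` to `𝒳 ξ`. -/
theorem norm_inner_le_arvesonDist (T : H →L[ℂ] H) {𝒳 : Submodule ℂ (H →L[ℂ] H)} {η ξ : H}
    (h : ∀ X ∈ 𝒳, ⟪η, X ξ⟫_ℂ = 0) : ‖⟪η, T ξ⟫_ℂ‖ ≤ arvesonDist T 𝒳 * (‖η‖ * ‖ξ‖) := by
  rcases eq_or_ne ξ 0 with rfl | hξ
  · simp
  rcases eq_or_ne η 0 with rfl | hη
  · simp
  have hξn := norm_pos_iff.mpr hξ
  have hηn := norm_pos_iff.mpr hη
  have hζ : ‖((‖ξ‖ : ℂ)⁻¹) • ξ‖ = 1 := by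
    rw [norm_smul, norm_inv, Complex.norm_real, norm_norm, inv_mul_cancel₀ hξn.ne']
  refine le_trans ?_ (mul_le_mul_of_nonneg_right (iInf_norm_le_arvesonDist T 𝒳 hζ)
    (by positivity : 0 ≤ ‖η‖ * ‖ξ‖))
  rw [← div_le_iff₀ (by positivity)]
  refine le_ciInf fun X => ?_
  rw [div_le_iff₀ (by positivity)]
  have e : T (((‖ξ‖ : ℂ)⁻¹) • ξ) - (X : H →L[ℂ] H) (((‖ξ‖ : ℂ)⁻¹) • ξ)
      = ((‖ξ‖ : ℂ)⁻¹) • (T ξ - (X : H →L[ℂ] H) ξ) := by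
    rw [map_smul, map_smul, smul_sub]
  rw [e, norm_smul, norm_inv, Complex.norm_real, norm_norm]
  calc ‖⟪η, T ξ⟫_ℂ‖ = ‖⟪η, T ξ - (X : H →L[ℂ] H) ξ⟫_ℂ‖ := by
        rw [inner_sub_right, h X X.2, sub_zero]
    _ ≤ ‖η‖ * ‖T ξ - (X : H →L[ℂ] H) ξ‖ := norm_inner_le_norm _ _
    _ = _ := by field_simp

/-- The sign `±1` of the membership of `i` in `S`. -/
noncomputable def sgn {J : Type*} [DecidableEq J] (S : Finset J) (i : J) : ℂ :=
  if i ∈ S then 1 else -1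

theorem conj_sgn {J : Type*} [DecidableEq J] (S : Finset J) (i : J) :
    (starRingEnd ℂ) (sgn S i) = sgn S i := by
  unfold sgn; split_ifs <;> simp

/-- Toggling the membership of `i` is an involution that flips the sign of each term. -/
theorem sum_sgn_mul_sgn {J : Type*} [DecidableEq J] {F : Finset J} {i j : J} (hi : i ∈ F)
    (hij : i ≠ j) : ∑ S ∈ F.powerset, sgn S i * sgn S j = 0 := by
  refine Finset.sum_involution (fun S _ => symmDiff S {i}) ?_ ?_ ?_ ?_
  · intro S _
    have h1 : sgn (symmDiff S {i}) i = - sgn S i := by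
      by_cases h : i ∈ S <;> simp [sgn, Finset.mem_symmDiff, h]
    have h2 : sgn (symmDiff S {i}) j = sgn S j := by
      by_cases h : j ∈ S <;> simp [sgn, Finset.mem_symmDiff, h, hij.symm]
    rw [h1, h2]; ring
  · intro S _ _ h
    have := congrArg (i ∈ ·) h
    simp [Finset.mem_symmDiff] at this
  · intro S hS
    rw [Finset.mem_powerset] at hS ⊢
    intro x hx
    rw [Finset.mem_symmDiff, Finset.mem_singleton] at hx
    rcases hx with ⟨hx, -⟩ | ⟨rfl, -⟩
    · exact hS hx
    · exact hi
  · intro S _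
    exact symmDiff_symmDiff_cancel_right _ _

/-- Averaging over all sign changes leaves only the diagonal of a form. -/
theorem sum_inner_sgn {J : Type*} [DecidableEq J] (T : H →L[ℂ] H) (F : Finset J) (η ξ : J → H)
    (hdiag : ∀ i ∈ F, ⟪η i, T (ξ i)⟫_ℂ = 0) :
    ∑ S ∈ F.powerset, ⟪∑ i ∈ F, sgn S i • η i, T (∑ j ∈ F, sgn S j • ξ j)⟫_ℂ = 0 := by
  simp only [map_sum, map_smul, sum_inner, inner_sum, inner_smul_left, inner_smul_right, conj_sgn]
  rw [Finset.sum_comm]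
  refine Finset.sum_eq_zero fun j hj => ?_
  simp only [Finset.mul_sum]
  rw [Finset.sum_comm]
  refine Finset.sum_eq_zero fun i _ => ?_
  simp only [← mul_assoc]
  rw [← Finset.sum_mul]
  rcases eq_or_ne j i with rfl | hij
  · rw [hdiag j hj, mul_zero]
  · rw [sum_sgn_mul_sgn hj hij, zero_mul]

/-- Cauchy–Schwarz and Pythagoras for `(‖p‖, ‖p'‖)` and `(‖q'‖, ‖q‖)`: two complementary
off-diagonal corners cost no more than one. -/
theorem norm_inner_add_le {C : ℝ} (hC : 0 ≤ C) {p p' q q' : H} {a b : ℂ} (hp : ⟪p, p'⟫_ℂ = 0)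
    (hq : ⟪q, q'⟫_ℂ = 0) (ha : ‖a‖ ≤ C * (‖p‖ * ‖q'‖)) (hb : ‖b‖ ≤ C * (‖p'‖ * ‖q‖)) :
    ‖a + b‖ ≤ C * (‖p + p'‖ * ‖q + q'‖) := by
  have h1 := norm_add_sq_eq_norm_sq_add_norm_sq_of_inner_eq_zero (𝕜 := ℂ) _ _ hp
  have h2 := norm_add_sq_eq_norm_sq_add_norm_sq_of_inner_eq_zero (𝕜 := ℂ) _ _ hq
  have h3 : ‖p‖ * ‖q'‖ + ‖p'‖ * ‖q‖ ≤ ‖p + p'‖ * ‖q + q'‖ := by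
    refine le_of_sq_le_sq ?_ (by positivity)
    have : (‖p + p'‖ * ‖q + q'‖) ^ 2
        = (‖p‖ * ‖p‖ + ‖p'‖ * ‖p'‖) * (‖q‖ * ‖q‖ + ‖q'‖ * ‖q'‖) := by
      rw [← h1, ← h2]; ring
    rw [this]
    nlinarith [sq_nonneg (‖p‖ * ‖q‖ - ‖p'‖ * ‖q'‖)]
  calc ‖a + b‖ ≤ ‖a‖ + ‖b‖ := norm_add_le _ _
    _ ≤ C * (‖p‖ * ‖q'‖) + C * (‖p'‖ * ‖q‖) := add_le_add ha hb
    _ = C * (‖p‖ * ‖q'‖ + ‖p'‖ * ‖q‖) := by ring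
    _ ≤ _ := by gcongr

theorem sum_sgn_smul {J : Type*} [DecidableEq J] {F S : Finset J} (hS : S ⊆ F) (η : J → H) :
    ∑ i ∈ F, sgn S i • η i = ∑ i ∈ S, η i - ∑ i ∈ F \ S, η i := by
  rw [← Finset.sum_sdiff hS, sub_eq_neg_add, ← Finset.sum_neg_distrib]
  congr 1
  · refine Finset.sum_congr rfl fun i hi => ?_
    rw [sgn, if_neg (Finset.mem_sdiff.mp hi).2, neg_smul, one_smul]
  · refine Finset.sum_congr rfl fun i hi => ?_
    rw [sgn, if_pos hi, one_smul]

variable {J : Type*} {M N : J → Submodule ℂ H}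

theorem inner_sum_sum_eq_zero {S S' : Finset J} (hS : Disjoint S S') {K : J → Submodule ℂ H}
    (hK : ∀ i j, i ≠ j → K i ⟂ K j) {x : J → H} (hx : ∀ i, x i ∈ K i) :
    ⟪∑ i ∈ S, x i, ∑ i ∈ S', x i⟫_ℂ = 0 := by
  rw [sum_inner]
  refine Finset.sum_eq_zero fun i hi => ?_
  rw [inner_sum]
  refine Finset.sum_eq_zero fun j hj => ?_
  exact Submodule.isOrtho_iff_inner_eq.mp
    (hK i j fun e => Finset.disjoint_left.mp hS hi (e ▸ hj)) _ (hx i) _ (hx j)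

theorem IsBlockDecomposition.norm_inner_perp_finset_le (h : IsBlockDecomposition Φ M N)
    (T : H →L[ℂ] H) (F : Finset J) {η ξ : J → H} (hη : ∀ i, η i ∈ M i) (hξ : ∀ i, ξ i ∈ N i) :
    ‖⟪∑ i ∈ F, η i, perp Φ T (∑ i ∈ F, ξ i)⟫_ℂ‖ ≤
      2 * arvesonDist T (LinearMap.range Φ) * (‖∑ i ∈ F, η i‖ * ‖∑ i ∈ F, ξ i‖) := by
  classical
  set α := arvesonDist T (LinearMap.range Φ) with hα
  set u := ∑ i ∈ F, η i with hu
  set v := ∑ i ∈ F, ξ i with hv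
  let Z := perp Φ T
  have hZ : ∀ x y, ⟪x, Z y⟫_ℂ = ⟪x, T y⟫_ℂ - ⟪x, Φ T y⟫_ℂ := fun x y => by
    rw [← inner_sub_right]; rfl
  have hoff : ∀ S S' : Finset J, Disjoint S S' → ∀ A,
      ⟪∑ i ∈ S, η i, Φ A (∑ j ∈ S', ξ j)⟫_ℂ = 0 := by
    intro S S' hS A
    rw [map_sum, sum_inner]
    refine Finset.sum_eq_zero fun i hi => ?_
    rw [inner_sum]
    refine Finset.sum_eq_zero fun j hj => ?_
    exact h.off_diagonal i j (fun e => Finset.disjoint_left.mp hS hi (e ▸ hj)) _ (hη i) _ (hξ j) A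
  have hoffZ : ∀ S S' : Finset J, Disjoint S S' →
      ‖⟪∑ i ∈ S, η i, Z (∑ j ∈ S', ξ j)⟫_ℂ‖ ≤ α * (‖∑ i ∈ S, η i‖ * ‖∑ j ∈ S', ξ j‖) := by
    intro S S' hS
    rw [hZ, hoff S S' hS, sub_zero]
    refine norm_inner_le_arvesonDist T ?_
    rintro _ ⟨A, rfl⟩
    exact hoff S S' hS A
  -- Changing signs off `S` preserves the parts on `S × S` and `(F \ S) × (F \ S)` and negates the
  -- two mixed ones. The difference is twice the mixed parts, which is where the constant 2 arises.
  have hpair : ∀ S ∈ F.powerset,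
      ‖⟪u, Z v⟫_ℂ - ⟪∑ i ∈ F, sgn S i • η i, Z (∑ j ∈ F, sgn S j • ξ j)⟫_ℂ‖
        ≤ 2 * α * (‖u‖ * ‖v‖) := by
    intro S hS
    rw [Finset.mem_powerset] at hS
    have hd : Disjoint S (F \ S) := Finset.disjoint_sdiff
    rw [sum_sgn_smul hS, sum_sgn_smul hS]
    have hu' : u = ∑ i ∈ S, η i + ∑ i ∈ F \ S, η i := by rw [add_comm, Finset.sum_sdiff hS]
    have hv' : v = ∑ i ∈ S, ξ i + ∑ i ∈ F \ S, ξ i := by rw [add_comm, Finset.sum_sdiff hS]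
    have hle := norm_inner_add_le (arvesonDist_nonneg T _)
      (inner_sum_sum_eq_zero hd h.ortho_left hη) (inner_sum_sum_eq_zero hd h.ortho_right hξ)
      (hoffZ _ _ hd) (hoffZ _ _ hd.symm)
    rw [← hu', ← hv'] at hle
    have e : ⟪u, Z v⟫_ℂ - ⟪∑ i ∈ S, η i - ∑ i ∈ F \ S, η i, Z (∑ i ∈ S, ξ i - ∑ i ∈ F \ S, ξ i)⟫_ℂ
        = 2 * (⟪∑ i ∈ S, η i, Z (∑ j ∈ F \ S, ξ j)⟫_ℂ
          + ⟪∑ i ∈ F \ S, η i, Z (∑ j ∈ S, ξ j)⟫_ℂ) := by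
      rw [hu', hv', map_add, map_sub]
      simp only [inner_add_left, inner_add_right, inner_sub_left, inner_sub_right]
      ring
    rw [e, norm_mul, Complex.norm_ofNat, mul_assoc]
    gcongr
  have hsum := sum_inner_sgn Z F η ξ fun i _ => by
    rw [hZ, h.fixes i _ (hη i) _ (hξ i), sub_self]
  have hcard : (0 : ℝ) < (F.powerset.card : ℝ) := by
    rw [Finset.card_powerset]; positivity
  have htot : (F.powerset.card : ℂ) * ⟪u, Z v⟫_ℂ = ∑ S ∈ F.powerset,
      (⟪u, Z v⟫_ℂ - ⟪∑ i ∈ F, sgn S i • η i, Z (∑ j ∈ F, sgn S j • ξ j)⟫_ℂ) := by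
    rw [Finset.sum_sub_distrib, hsum, sub_zero, Finset.sum_const, nsmul_eq_mul]
  have hfin := (norm_sum_le F.powerset fun S =>
    ⟪u, Z v⟫_ℂ - ⟪∑ i ∈ F, sgn S i • η i, Z (∑ j ∈ F, sgn S j • ξ j)⟫_ℂ).trans
    (Finset.sum_le_sum hpair)
  rw [← htot, Finset.sum_const, nsmul_eq_mul, norm_mul, Complex.norm_natCast] at hfin
  exact le_of_mul_le_mul_left hfin hcard

theorem IsBlockDecomposition.norm_inner_perp_le (h : IsBlockDecomposition Φ M N)
    (T : H →L[ℂ] H) {u v : H} (hu : u ∈ ⨆ j, M j) (hv : v ∈ ⨆ j, N j) :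
    ‖⟪u, perp Φ T v⟫_ℂ‖ ≤ 2 * arvesonDist T (LinearMap.range Φ) * (‖u‖ * ‖v‖) := by
  classical
  obtain ⟨f, hf, rfl⟩ := (Submodule.mem_iSup_iff_exists_finsupp _ _).mp hu
  obtain ⟨g, hg, rfl⟩ := (Submodule.mem_iSup_iff_exists_finsupp _ _).mp hv
  have e1 : f.sum (fun _ x => x) = ∑ i ∈ f.support ∪ g.support, f i :=
    Finsupp.sum_of_support_subset f Finset.subset_union_left _ fun _ _ => rfl
  have e2 : g.sum (fun _ x => x) = ∑ i ∈ f.support ∪ g.support, g i :=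
    Finsupp.sum_of_support_subset g Finset.subset_union_right _ fun _ _ => rfl
  rw [e1, e2]
  exact h.norm_inner_perp_finset_le T _ hf hg

variable [CompleteSpace H]

theorem mem_closure_of_orthogonal_eq_bot {K : Submodule ℂ H} (hK : Kᗮ = ⊥) {s : Set H}
    (hs : IsClosed s) (hKs : ∀ x ∈ K, x ∈ s) (x : H) : x ∈ s := by
  refine closure_minimal hKs hs ?_
  have h := (Submodule.topologicalClosure_eq_top_iff (K := K)).mpr hK
  have hx : x ∈ K.topologicalClosure := h ▸ Submodule.mem_top
  exact hx

theorem IsBlockDecomposition.arvesonBound (h : IsBlockDecomposition Φ M N) :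
    ArvesonBound Φ 2 := by
  intro T
  have hα := arvesonDist_nonneg T (LinearMap.range Φ)
  have key : ∀ u v, ‖⟪u, perp Φ T v⟫_ℂ‖ ≤
      2 * arvesonDist T (LinearMap.range Φ) * (‖u‖ * ‖v‖) := by
    intro u v
    refine mem_closure_of_orthogonal_eq_bot h.dense_left (s := {u | ‖⟪u, perp Φ T v⟫_ℂ‖ ≤
      2 * arvesonDist T (LinearMap.range Φ) * (‖u‖ * ‖v‖)})
      (isClosed_le (by fun_prop) (by fun_prop)) (fun u hu => ?_) u
    refine mem_closure_of_orthogonal_eq_bot h.dense_right (s := {v | ‖⟪u, perp Φ T v⟫_ℂ‖ ≤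
      2 * arvesonDist T (LinearMap.range Φ) * (‖u‖ * ‖v‖)})
      (isClosed_le (by fun_prop) (by fun_prop)) (fun v hv => ?_) v
    exact h.norm_inner_perp_le T hu hv
  refine ContinuousLinearMap.opNorm_le_bound _ (by positivity) fun v => ?_
  rcases eq_or_ne (perp Φ T v) 0 with h0 | h0
  · rw [h0, norm_zero]; positivity
  have h1 := key (perp Φ T v) v
  rw [inner_self_eq_norm_sq_to_K, norm_pow, RCLike.norm_ofReal, abs_norm] at h1
  have h2 := norm_pos_iff.mpr h0
  nlinarith

/-! ### The range of `Φ`: block-diagonal operators, ternary products, weak* closedness. -/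

omit [CompleteSpace H] in
theorem mem_orthogonal_iSup {K : J → Submodule ℂ H} {z : H} (h : ∀ k, ∀ x ∈ K k, ⟪x, z⟫_ℂ = 0) :
    z ∈ (⨆ j, K j)ᗮ := by
  rw [← Submodule.iInf_orthogonal, Submodule.mem_iInf]
  exact fun k => (Submodule.mem_orthogonal _ _).mpr (h k)

theorem mem_of_forall_inner_eq_zero {K : J → Submodule ℂ H} (hcl : ∀ j, IsClosed (K j : Set H))
    (hortho : ∀ i j, i ≠ j → K i ⟂ K j) (hdense : (⨆ j, K j)ᗮ = ⊥) {j : J} {z : H}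
    (hz : ∀ k, k ≠ j → ∀ x ∈ K k, ⟪x, z⟫_ℂ = 0) : z ∈ K j := by
  have : CompleteSpace (K j) := (hcl j).completeSpace_coe
  have h : z - (K j).starProjection z ∈ (⨆ j, K j)ᗮ := by
    refine mem_orthogonal_iSup fun k x hx => ?_
    rcases eq_or_ne k j with rfl | hkj
    · exact Submodule.inner_right_of_mem_orthogonal hx
        (Submodule.sub_starProjection_mem_orthogonal z)
    · rw [inner_sub_right, hz k hkj x hx, Submodule.isOrtho_iff_inner_eq.mp (hortho k j hkj) x hx _
        (Submodule.starProjection_apply_mem _ _), sub_zero]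
  rw [hdense, Submodule.mem_bot, sub_eq_zero] at h
  rw [h]
  exact Submodule.starProjection_apply_mem _ _

/-- `Φ X` and `X` agree on diagonal blocks and both vanish off them; density of the blocks gives `Φ
X = X`. -/
theorem IsBlockDecomposition.mem_range (h : IsBlockDecomposition Φ M N) {X : H →L[ℂ] H}
    (hX : ∀ i j, i ≠ j → ∀ η ∈ M i, ∀ ξ ∈ N j, ⟪η, X ξ⟫_ℂ = 0) : X ∈ LinearMap.range Φ := by
  refine ⟨X, ?_⟩
  rw [← sub_eq_zero]
  ext v
  refine mem_closure_of_orthogonal_eq_bot h.dense_right (s := {v | (Φ X - X) v = 0})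
    (isClosed_eq (by fun_prop) continuous_const) (fun v hv => ?_) v
  have hle : (⨆ j, N j) ≤ LinearMap.ker ((Φ X - X : H →L[ℂ] H) : H →ₗ[ℂ] H) := by
    refine iSup_le fun j ξ hξ => ?_
    have h0 : (Φ X - X) ξ ∈ (⨆ j, M j)ᗮ := by
      refine mem_orthogonal_iSup fun i η hη => ?_
      rw [sub_apply, inner_sub_right]
      rcases eq_or_ne i j with rfl | hij
      · rw [h.fixes i η hη ξ hξ, sub_self]
      · rw [h.off_diagonal i j hij η hη ξ hξ, hX i j hij η hη ξ hξ, sub_zero]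
    rw [h.dense_left] at h0
    exact h0
  exact hle hv

theorem IsBlockDecomposition.apply_mem (h : IsBlockDecomposition Φ M N) {X : H →L[ℂ] H}
    (hX : X ∈ LinearMap.range Φ) {j : J} {ξ : H} (hξ : ξ ∈ N j) : X ξ ∈ M j := by
  obtain ⟨A, rfl⟩ := hX
  exact mem_of_forall_inner_eq_zero h.isClosed_left h.ortho_left h.dense_left
    fun k hk η hη => h.off_diagonal k j hk η hη ξ hξ A

theorem IsBlockDecomposition.star_apply_mem (h : IsBlockDecomposition Φ M N) {X : H →L[ℂ] H}
    (hX : X ∈ LinearMap.range Φ) {j : J} {η : H} (hη : η ∈ M j) : (star X) η ∈ N j := by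
  obtain ⟨A, rfl⟩ := hX
  refine mem_of_forall_inner_eq_zero h.isClosed_right h.ortho_right h.dense_right
    fun k hk ξ hξ => ?_
  rw [star_inner_right, ← inner_conj_symm, h.off_diagonal j k hk.symm η hη ξ hξ, map_zero]

/-- `R` and `S` map `N j` into `M j`, and `T*` maps `M j` back into `N j`, so the product is block
diagonal. -/
theorem IsBlockDecomposition.ternary (h : IsBlockDecomposition Φ M N) {S T R : H →L[ℂ] H}
    (hS : S ∈ LinearMap.range Φ) (hT : T ∈ LinearMap.range Φ) (hR : R ∈ LinearMap.range Φ) :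
    S * star T * R ∈ LinearMap.range Φ := by
  refine h.mem_range fun i j hij η hη ξ hξ => ?_
  exact Submodule.isOrtho_iff_inner_eq.mp (h.ortho_left i j hij) η hη _
    (h.apply_mem hS (h.star_apply_mem hT (h.apply_mem hR hξ)))

omit [CompleteSpace H] in
theorem mem_range_iff_of_idempotent (h : Φ ∘ₗ Φ = Φ) {X : H →L[ℂ] H} :
    X ∈ LinearMap.range Φ ↔ Φ X = X := by
  constructor
  · rintro ⟨A, rfl⟩
    rw [← LinearMap.comp_apply, h]
  · intro hX
    exact ⟨X, hX⟩

theorem IsSchurIdempotent.isMasaBimodule {D : StarSubalgebra ℂ (H →L[ℂ] H)}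
    (hΦ : IsSchurIdempotent D Φ) : IsMasaBimodule D (LinearMap.range Φ) where
  weakStar_closed := by
    -- The range of an idempotent is its fixed point set, cut out here by equations between weak*
    -- continuous functionals.
    have e : (LinearMap.range Φ : Set (H →L[ℂ] H)) =
        ⋂ (u : H) (v : H), {X | ⟪u, Φ X v⟫_ℂ = ⟪u, X v⟫_ℂ} := by
      ext X
      rw [SetLike.mem_coe, mem_range_iff_of_idempotent hΦ.idempotent]
      simp only [Set.mem_iInter]
      refine ⟨fun hX u v => ?_, fun hX => ?_⟩
      · rw [Set.mem_ofPred_eq, hX]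
      · ext v
        exact ext_inner_left ℂ fun u => hX u v
    rw [e]
    let _ := weakStar H
    refine isClosed_iInter fun u => isClosed_iInter fun v => ?_
    exact isClosed_eq ((continuous_inner_apply u v).comp hΦ.weakStar_continuous)
      (continuous_inner_apply u v)
  mul_mem := by
    rintro A hA B hB _ ⟨X, rfl⟩
    exact ⟨A * X * B, hΦ.bimodule_map A hA B hB X⟩

omit [CompleteSpace H] in
theorem ArvesonBound.isHyperreflexive {l : ℝ} (hl : 0 < l) (h : ArvesonBound Φ l) :
    IsHyperreflexive (LinearMap.range Φ) :=
  ⟨l, hl, fun T => (ciInf_le ⟨0, by rintro _ ⟨X, rfl⟩; exact norm_nonneg _⟩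
    (⟨Φ T, T, rfl⟩ : LinearMap.range Φ)).trans (h T)⟩

end ArvesonBound
end SchurIdem

theorem proposition3p8 {H : Type*} [NormedAddCommGroup H] [InnerProductSpace ℂ H]
    [CompleteSpace H] [TopologicalSpace.SeparableSpace H]
    (D : StarSubalgebra ℂ (H →L[ℂ] H)) (hD : SchurIdem.IsMasa D)
    (Φ : (H →L[ℂ] H) →ₗ[ℂ] (H →L[ℂ] H)) (hΦ : SchurIdem.IsSchurIdempotent D Φ)
    (hc : SchurIdem.IsContractive Φ) :
    (Φ ∈ SchurIdem.classH D ∧ SchurIdem.lam Φ ≤ 2) ∧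
      SchurIdem.IsTernaryMasaBimodule D (LinearMap.range Φ) ∧
      SchurIdem.IsHyperreflexive (LinearMap.range Φ) := by
  have hdec := SchurIdem.isBlockDecomposition hD hΦ hc
  have hbound := hdec.arvesonBound
  refine ⟨⟨⟨hΦ, 2, two_pos, hbound⟩, csInf_le ⟨0, fun l hl => hl.1.le⟩ ⟨two_pos, hbound⟩⟩,
    ⟨hΦ.isMasaBimodule, fun S hS T hT R hR => hdec.ternary hS hT hR⟩,
    hbound.isHyperreflexive two_pos⟩
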